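/- Consider the symmetric two-user Gaussian interference relay channel with real gains $h_d,h_r,h_{sr}\ge 0$, $h_c>0$ and power $P\ge 0$. At time $k$ the receivers and the relay observe $$y_{1k}=h_dx_{1k}+h_cx_{2k}+h_rx_{rk}+z_{1k},\qquad y_{2k}=h_dx_{2k}+h_cx_{1k}+h_rx_{rk}+z_{2k},\qquad y_{rk}=h_{sr}x_{1k}+h_{sr}x_{2k}+z_{rk},$$ where all noise samples are independent standard Gaussian variables. For $i\in\{1,2\}$, transmitter $i$ encodes a message $m_i$ into $x_i^n$, and receiver $i$ decodes $m_i$ from $y_i^n$; the messages are independent of each other and of the noise, and $m_i$ is uniform on a set of $2^{nR_i}$ (rounded up to an integer) elements. The relay is causal: $x_{rk}$ is a (measurable, possibly time-dependent) function of $y_{r1},\dots,y_{r,k-1}$. Each of the three inputs satisfies $\frac1n\sum_{k=1}^n\mathbb E[X_{ik}^2]\le P$, $i\in\{1,2,r\}$. A pair $(R_1,R_2)$ of nonnegative rates is achievable if some sequence of such codes has $P(\hat m_1\ne m_1\text{ or }\hat m_2\ne m_2)\to 0$ as $n\to\infty$; the capacity region is the closure of the set of achievable pairs, and the sum-capacity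 $C_\Sigma$ is the supremum of $R_1+R_2$ over the capacity region. Put $C(x)=\tfrac12\log_2(1+x)$ and $C^+(x)=\max\{0,C(x)\}$ (with $C^+(-1)=0$). Then $$C_\Sigma\le C(2h_{sr}^2P)+C(h_d^2P+h_c^2P)+C^+\!\left(\frac{h_d^2}{h_c^2}-1\right),$$ and, if moreover $h_{sr}>0$, $$C_\Sigma\le 2\,C\!\left(\frac{h_c^2}{h_{sr}^2}+\Bigl(1-\frac{h_d}{h_c}\Bigr)^2\right)+2\,C(2h_{sr}^2P).$$ -/

import Mathlib

open MeasureTheory ProbabilityTheory Filter Topology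

noncomputable section

namespace InterferenceRelay

/-- Parameters of the symmetric Gaussian interference relay channel: the direct gain `hd`, the
cross gain `hc`, the relay-receiver gain `hr`, the source-relay gain `hsr`, and the power `P`
available to each source and to the relay. -/
structure Channel where
  hd : ℝ
  hc : ℝ
  hr : ℝ
  hsr : ℝ
  P : ℝ

/-- `C(x) = (1/2) log₂ (1 + x)`; rates are measured in bits per channel use. -/
def C (x : ℝ) : ℝ := (1 / 2) * Real.logb 2 (1 + x)

/-- `C⁺(x) = max {0, C(x)}`. -/
def Cplus (x : ℝ) : ℝ := max 0 (C x)

/-- A code of block length `n` with `M₁` and `M₂` messages. At time `k` the relay applies a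
function of its strictly earlier observations, so it is causal. -/
structure Code (M₁ M₂ n : ℕ) where
  /-- encoder of transmitter 1 -/
  enc₁ : Fin M₁ → Fin n → ℝ
  /-- encoder of transmitter 2 -/
  enc₂ : Fin M₂ → Fin n → ℝ
  /-- relay function at each time `k` -/
  relay : (k : Fin n) → (Fin k → ℝ) → ℝ
  /-- decoder of receiver 1 -/
  dec₁ : (Fin n → ℝ) → Fin M₁
  /-- decoder of receiver 2 -/
  dec₂ : (Fin n → ℝ) → Fin M₂
  measurable_relay : ∀ k, Measurable (relay k)
  measurable_dec₁ : Measurable dec₁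
  measurable_dec₂ : Measurable dec₂

/-- Sample space of a block: the two messages, and the noise sequences at receiver 1, at
receiver 2 and at the relay. -/
abbrev Outcome (M₁ M₂ n : ℕ) : Type :=
  (Fin M₁ × Fin M₂) × ((Fin n → ℝ) × (Fin n → ℝ) × (Fin n → ℝ))

/-- Noise of `n` channel uses at one node: i.i.d. standard Gaussian samples. -/
def noise (n : ℕ) : Measure (Fin n → ℝ) := Measure.pi fun _ => gaussianReal 0 1

/-- Joint law of messages and noises: uniform messages and Gaussian noises, all independent. -/
def law (M₁ M₂ n : ℕ) : Measure (Outcome M₁ M₂ n) :=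
  ((uniformOn Set.univ).prod (uniformOn Set.univ)).prod
    ((noise n).prod ((noise n).prod (noise n)))

/-- Block power constraint `(1/n) ∑ₖ E[Xₖ²] ≤ P`. The expectation is a Lebesgue integral
with values in `[0, ∞]`, so it is infinite where `Xₖ` is not square integrable. -/
def PowerConstraint {M₁ M₂ n : ℕ} (P : ℝ) (X : Outcome M₁ M₂ n → Fin n → ℝ) : Prop :=
  ∑ k, ∫⁻ ω, ENNReal.ofReal (X ω k ^ 2) ∂(law M₁ M₂ n) ≤ ENNReal.ofReal (n * P)

namespace Code

variable {M₁ M₂ n : ℕ} (c : Code M₁ M₂ n) (ch : Channel)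

/-- Channel input of transmitter 1. -/
def x₁ (ω : Outcome M₁ M₂ n) : Fin n → ℝ := c.enc₁ ω.1.1

/-- Channel input of transmitter 2. -/
def x₂ (ω : Outcome M₁ M₂ n) : Fin n → ℝ := c.enc₂ ω.1.2

/-- Observation of the relay. -/
def yr (ω : Outcome M₁ M₂ n) : Fin n → ℝ := fun k =>
  ch.hsr * c.x₁ ω k + ch.hsr * c.x₂ ω k + ω.2.2.2 k

/-- Channel input of the relay, a function of its observations before time `k`. -/
def xr (ω : Outcome M₁ M₂ n) : Fin n → ℝ := fun k =>
  c.relay k fun j => c.yr ch ω (Fin.castLE k.isLt.le j)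

/-- Observation of receiver 1. -/
def y₁ (ω : Outcome M₁ M₂ n) : Fin n → ℝ := fun k =>
  ch.hd * c.x₁ ω k + ch.hc * c.x₂ ω k + ch.hr * c.xr ch ω k + ω.2.1 k

/-- Observation of receiver 2. -/
def y₂ (ω : Outcome M₁ M₂ n) : Fin n → ℝ := fun k =>
  ch.hd * c.x₂ ω k + ch.hc * c.x₁ ω k + ch.hr * c.xr ch ω k + ω.2.2.1 k

/-- The power constraints at both sources and at the relay. -/
def Admissible : Prop :=
  PowerConstraint ch.P c.x₁ ∧ PowerConstraint ch.P c.x₂ ∧ PowerConstraint ch.P (c.xr ch)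

/-- Probability that at least one receiver decodes its message wrongly. -/
def errorProb : ℝ :=
  (law M₁ M₂ n).real {ω | c.dec₁ (c.y₁ ch ω) ≠ ω.1.1 ∨ c.dec₂ (c.y₂ ch ω) ≠ ω.1.2}

end Code

/-- Number of messages at rate `R` and block length `n`: `2^(nR)`, rounded up to an integer. -/
def numMessages (R : ℝ) (n : ℕ) : ℕ := ⌈(2 : ℝ) ^ ((n : ℝ) * R)⌉₊

/-- `(R₁, R₂)` is achievable if some sequence of admissible codes with these rates has error
probability tending to zero. -/
def Achievable (ch : Channel) (R : ℝ × ℝ) : Prop :=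
  0 ≤ R.1 ∧ 0 ≤ R.2 ∧
    ∃ c : (n : ℕ) → Code (numMessages R.1 n) (numMessages R.2 n) n,
      (∀ n, (c n).Admissible ch) ∧ Tendsto (fun n => (c n).errorProb ch) atTop (𝓝 0)

/-- Capacity region: closure of the set of achievable rate pairs. -/
def capacityRegion (ch : Channel) : Set (ℝ × ℝ) := closure {R | Achievable ch R}

/-- Sum capacity: the supremum of `R₁ + R₂` over the capacity region, taken in the extended
reals so that no boundedness is presupposed. -/
def sumCapacity (ch : Channel) : EReal :=
  ⨆ R ∈ capacityRegion ch, ((R.1 + R.2 : ℝ) : EReal)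

end InterferenceRelay

end

/-!
Both bounds are converses. Once the messages are fixed, the relay's input is a function of its own
observations `yr`, so a receiver that is also given `yr` may subtract it; what remains is a Gaussian
vector with deterministic message-dependent mean. All observations then have explicit densities
(finite mixtures of shifted Gaussians), and no differential entropy is needed: every step is an
instance of `E[log r] ≤ E[r] - 1 ≤ 0` for a likelihood ratio `r` whose numerator is a probability
density (`lintegral_law_le_one`, `integral_nonpos_of_le_sum_sub_one`). Fano's inequality enters by
putting a softened version of the decoder's guess into the numerator
(`le_log_card_mul_softGuess`), and the Gaussian maximum-entropy bounds enter by taking Gaussian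
reference densities there (`le_integral_log_gaussDensity_sub_log`).

*First bound.* Let `τ = min(1, hc / hd)`. A single receiver that observes `yr` and receiver 1's
signal with its noise scaled down by `τ` can recover both messages: by adding noise it simulates
receiver 1; knowing `m₁`, it removes `x₁`, rescales, adds noise and simulates receiver 2
(`Code.joint_bound`). The multiple-access bound for this receiver (`joint_decoding_bound`) gives the
rate `C((hd² + hc²) P / τ²) + C(2 hsr² P)`, and the factor `1 / τ²` costs at most
`C⁺(hd² / hc² - 1)`.

*Second bound.* A genie gives receiver 1 the pair `(t₁, yr)` with `t₁ = hc x₁ + z₂`, and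
symmetrically for receiver 2 with `t₂ = hc x₂ + z₁`. The affine estimate
`(hc / hsr) yr - (1 - hd / hc) t₁` of receiver 1's signal has an error free of codewords, of variance
`1 + hc² / hsr² + (1 - hd / hc)²`. Once `x₁` is removed, receiver 1 is left with `t₂` and a noisy
observation of `x₂`; hence the mixture densities in the denominator of one user's ratio
(`fanoRatio`) are those in the numerator of a second ratio of the other user (`relayRatio`), which
compares the relay's observation with a Gaussian one. In the product of the four ratios all mixtures
cancel and only Gaussian densities remain (`genie_bound`), leaving `C(hsr² P)` per user for the
relay's observation.

Letting the block length tend to infinity turns these bounds into bounds on the rates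
(`sum_rate_le_of_bound`), which pass to the closure.
-/

open MeasureTheory ProbabilityTheory Filter Topology
open scoped ENNReal NNReal

namespace InterferenceRelay

/-! ### Gaussian densities and noise -/

/-- The density of `n` i.i.d. centred Gaussian samples of variance `v`. -/
noncomputable def gaussDensity {n : ℕ} (v : ℝ≥0) (y : Fin n → ℝ) : ℝ :=
  ∏ k, gaussianPDFReal 0 v (y k)

section Gaussian

variable {n : ℕ} {v : ℝ≥0}

lemma gaussDensity_pos (hv : v ≠ 0) (y : Fin n → ℝ) : 0 < gaussDensity v y :=
  Finset.prod_pos fun _ _ => gaussianPDFReal_pos _ _ _ hv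

lemma gaussDensity_nonneg (y : Fin n → ℝ) : 0 ≤ gaussDensity v y :=
  Finset.prod_nonneg fun _ _ => gaussianPDFReal_nonneg _ _ _

@[fun_prop]
lemma measurable_gaussDensity : Measurable (gaussDensity v : (Fin n → ℝ) → ℝ) :=
  Finset.measurable_prod _ fun k _ => (measurable_gaussianPDFReal 0 v).comp (measurable_pi_apply k)

lemma log_gaussDensity (hv : v ≠ 0) (y : Fin n → ℝ) :
    Real.log (gaussDensity v y)
      = -(n / 2 * Real.log (2 * Real.pi * v)) - (∑ k, y k ^ 2) / (2 * v) := by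
  have hv' : (0 : ℝ) < v := lt_of_le_of_ne v.2 (by exact_mod_cast hv.symm)
  rw [gaussDensity, Real.log_prod (fun k _ => (gaussianPDFReal_pos 0 v (y k) hv).ne'),
    Finset.sum_div]
  have h : ∀ k, Real.log (gaussianPDFReal 0 v (y k))
      = -(1 / 2 * Real.log (2 * Real.pi * v)) - y k ^ 2 / (2 * v) := by
    intro k
    rw [gaussianPDFReal, Real.log_mul (by positivity) (Real.exp_pos _).ne', Real.log_exp,
      Real.log_inv, Real.log_sqrt (by positivity)]
    ring
  simp only [h, Finset.sum_sub_distrib, Finset.sum_const, Finset.card_univ, Fintype.card_fin,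
    nsmul_eq_mul]
  ring

lemma pi_gaussianReal_eq_withDensity (hv : v ≠ 0) :
    Measure.pi (fun _ : Fin n => gaussianReal 0 v)
      = volume.withDensity fun y => ENNReal.ofReal (gaussDensity v y) := by
  refine Measure.pi_eq fun s hs => ?_
  have hind : ∀ y : Fin n → ℝ, (Set.univ.pi s).indicator
      (fun y => ENNReal.ofReal (gaussDensity v y)) y
      = ENNReal.ofReal (∏ k, (s k).indicator (gaussianPDFReal 0 v) (y k)) := by
    intro y
    by_cases hy : y ∈ Set.univ.pi s
    · rw [Set.indicator_of_mem hy, gaussDensity]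
      congr 1
      refine Finset.prod_congr rfl fun k _ => ?_
      rw [Set.indicator_of_mem (hy k trivial)]
    · rw [Set.indicator_of_notMem hy]
      simp only [Set.mem_pi, Set.mem_univ, true_imp_iff, not_forall] at hy
      obtain ⟨k, hk⟩ := hy
      rw [Finset.prod_eq_zero (Finset.mem_univ k) (Set.indicator_of_notMem hk _),
        ENNReal.ofReal_zero]
  have hint : ∀ k, Integrable ((s k).indicator (gaussianPDFReal 0 v)) :=
    fun k => (integrable_gaussianPDFReal 0 v).indicator (hs k)
  have hnn : ∀ k x, 0 ≤ (s k).indicator (gaussianPDFReal 0 v) x :=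
    fun k x => Set.indicator_nonneg (fun x _ => gaussianPDFReal_nonneg _ _ x) x
  rw [withDensity_apply _ (MeasurableSet.univ_pi hs),
    ← lintegral_indicator (MeasurableSet.univ_pi hs)]
  simp only [hind]
  rw [volume_pi, ← ofReal_integral_eq_lintegral_ofReal (Integrable.fintype_prod_dep hint)
    (ae_of_all _ fun y => Finset.prod_nonneg fun k _ => hnn k _),
    ← volume_pi, integral_fintype_prod_volume_eq_prod,
    ENNReal.ofReal_prod_of_nonneg (fun k _ => integral_nonneg (hnn k))]
  refine Finset.prod_congr rfl fun k _ => ?_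
  rw [integral_indicator (hs k), gaussianReal_apply_eq_integral 0 hv]

lemma lintegral_gaussDensity_sub (hv : v ≠ 0) (m : Fin n → ℝ) :
    ∫⁻ y : Fin n → ℝ, ENNReal.ofReal (gaussDensity v (y - m)) = 1 := by
  rw [lintegral_sub_right_eq_self (fun y => ENNReal.ofReal (gaussDensity v y)) m]
  have h := congrArg (fun μ => μ Set.univ) (pi_gaussianReal_eq_withDensity (n := n) hv)
  simpa [withDensity_apply] using h.symm

instance : IsProbabilityMeasure (noise n) := by unfold noise; infer_instance

lemma noise_eq_withDensity :
    noise n = volume.withDensity fun y => ENNReal.ofReal (gaussDensity 1 y) :=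
  pi_gaussianReal_eq_withDensity one_ne_zero

/-- The joint density of the standard Gaussian noises at the two receivers and at the relay. -/
noncomputable def noiseDensity (z : (Fin n → ℝ) × (Fin n → ℝ) × (Fin n → ℝ)) : ℝ :=
  gaussDensity 1 z.1 * (gaussDensity 1 z.2.1 * gaussDensity 1 z.2.2)

lemma noiseDensity_nonneg (z : (Fin n → ℝ) × (Fin n → ℝ) × (Fin n → ℝ)) : 0 ≤ noiseDensity z :=
  mul_nonneg (gaussDensity_nonneg _) (mul_nonneg (gaussDensity_nonneg _) (gaussDensity_nonneg _))

@[fun_prop]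
lemma measurable_noiseDensity :
    Measurable (noiseDensity : (Fin n → ℝ) × (Fin n → ℝ) × (Fin n → ℝ) → ℝ) := by
  unfold noiseDensity; fun_prop

lemma noise_prod_eq_withDensity :
    (noise n).prod ((noise n).prod (noise n))
      = volume.withDensity fun z => ENNReal.ofReal (noiseDensity z) := by
  have h : Measurable fun y : Fin n → ℝ => ENNReal.ofReal (gaussDensity 1 y) := by fun_prop
  rw [noise_eq_withDensity, prod_withDensity h h, prod_withDensity h (by fun_prop)]
  simp only [noiseDensity]
  congr 1
  ext z
  rw [ENNReal.ofReal_mul (gaussDensity_nonneg _), ENNReal.ofReal_mul (gaussDensity_nonneg _)]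

lemma lintegral_sq_gaussianReal (u c : ℝ) :
    ∫⁻ x, ENNReal.ofReal ((u + c * x) ^ 2) ∂gaussianReal 0 1 = ENNReal.ofReal (u ^ 2 + c ^ 2) := by
  have h2 : MemLp (fun x : ℝ => x) 2 (gaussianReal 0 1) := memLp_id_gaussianReal 2
  have hi1 : Integrable (fun x : ℝ => x) (gaussianReal 0 1) := h2.integrable one_le_two
  have hi2 : Integrable (fun x : ℝ => x ^ 2) (gaussianReal 0 1) := h2.integrable_sq
  have e2 : ∫ x, x ^ 2 ∂gaussianReal 0 1 = 1 := by
    have := variance_fun_id_gaussianReal (μ := 0) (v := 1)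
    rw [variance_of_integral_eq_zero (by fun_prop) (by simp)] at this
    simpa using this
  have e : (fun x : ℝ => (u + c * x) ^ 2) = fun x => u ^ 2 + 2 * u * c * x + c ^ 2 * x ^ 2 := by
    ext x; ring
  have hi : Integrable (fun x : ℝ => u ^ 2 + 2 * u * c * x) (gaussianReal 0 1) :=
    (integrable_const _).add (hi1.const_mul _)
  rw [← ofReal_integral_eq_lintegral_ofReal _ (ae_of_all _ fun x => sq_nonneg _), e,
    integral_add hi (hi2.const_mul _), integral_add (integrable_const _) (hi1.const_mul _),
    integral_const_mul, integral_const_mul, e2]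
  · simp
  · rw [e]; exact hi.add (hi2.const_mul _)

lemma lintegral_sq_noise (u c : ℝ) (k : Fin n) :
    ∫⁻ z, ENNReal.ofReal ((u + c * z k) ^ 2) ∂noise n = ENNReal.ofReal (u ^ 2 + c ^ 2) := by
  rw [← lintegral_sq_gaussianReal]
  exact (measurePreserving_eval (fun _ : Fin n => gaussianReal 0 1) k).lintegral_comp
    (f := fun x => ENNReal.ofReal ((u + c * x) ^ 2)) (by fun_prop)

lemma lintegral_sq_noise_prod (u a b c : ℝ) (k : Fin n) :
    ∫⁻ z, ENNReal.ofReal ((a * z.1 k + b * z.2.1 k + c * z.2.2 k + u) ^ 2)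
        ∂(noise n).prod ((noise n).prod (noise n))
      = ENNReal.ofReal (a ^ 2 + b ^ 2 + c ^ 2 + u ^ 2) := by
  have hsplit : ∀ w : ℝ, 0 ≤ w → ∀ s t : ℝ,
      ∫⁻ z, ENNReal.ofReal ((s + t * z k) ^ 2 + w) ∂noise n
        = ENNReal.ofReal (s ^ 2 + t ^ 2 + w) := by
    intro w hw s t
    simp_rw [fun z : Fin n → ℝ => ENNReal.ofReal_add (sq_nonneg (s + t * z k)) hw]
    rw [lintegral_add_right _ measurable_const, lintegral_sq_noise, lintegral_const,
      ENNReal.ofReal_add (by positivity) hw]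
    simp
  rw [lintegral_prod _ (by fun_prop)]
  have h1 : ∀ x : Fin n → ℝ, ∫⁻ z, ENNReal.ofReal ((a * x k + b * z.1 k + c * z.2 k + u) ^ 2)
      ∂(noise n).prod (noise n) = ENNReal.ofReal ((u + a * x k) ^ 2 + (b ^ 2 + c ^ 2)) := by
    intro x
    rw [lintegral_prod _ (by fun_prop)]
    have h2 : ∀ y : Fin n → ℝ, ∫⁻ z, ENNReal.ofReal ((a * x k + b * y k + c * z k + u) ^ 2)
        ∂(noise n) = ENNReal.ofReal ((u + a * x k + b * y k) ^ 2 + c ^ 2) := by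
      intro y
      rw [← lintegral_sq_noise _ _ k]
      refine lintegral_congr fun z => ?_
      ring_nf
    simp_rw [h2]
    rw [hsplit _ (sq_nonneg c)]
    ring_nf
  simp_rw [h1]
  rw [hsplit _ (by positivity)]
  ring_nf

/-- Mixing two independent noise blocks by a rotation gives a noise block. -/
lemma map_noise_rotate {α β : ℝ} (h : α ^ 2 + β ^ 2 = 1) :
    ((noise n).prod (noise n)).map (fun p k => α * p.1 k + β * p.2 k) = noise n := by
  have h1 : ((gaussianReal 0 1).prod (gaussianReal 0 1)).map (fun p : ℝ × ℝ => α * p.1 + β * p.2)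
      = gaussianReal 0 1 := by
    have : (fun p : ℝ × ℝ => α * p.1 + β * p.2)
        = (fun p : ℝ × ℝ => p.1 + p.2) ∘ Prod.map (fun x => α * x) (fun x => β * x) := rfl
    rw [this, ← Measure.map_map (by fun_prop) (by fun_prop),
      ← Measure.map_prod_map _ _ (by fun_prop) (by fun_prop),
      gaussianReal_map_const_mul, gaussianReal_map_const_mul]
    have := gaussianReal_conv_gaussianReal (m₁ := α * 0) (m₂ := β * 0)
      (v₁ := ⟨α ^ 2, sq_nonneg α⟩ * 1) (v₂ := ⟨β ^ 2, sq_nonneg β⟩ * 1)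
    rw [Measure.conv] at this
    refine this.trans ?_
    congr 1
    · simp
    · ext; change α ^ 2 * 1 + β ^ 2 * 1 = 1; linarith
  have h2 := (measurePreserving_arrowProdEquivProdArrow ℝ ℝ (Fin n)
    (fun _ => gaussianReal 0 1) (fun _ => gaussianReal 0 1)).map_eq
  unfold noise
  rw [← h2, Measure.map_map (by fun_prop) (by fun_prop)]
  have h3 := Measure.pi_map_pi (μ := fun _ : Fin n => (gaussianReal 0 1).prod (gaussianReal 0 1))
    (f := fun _ => fun p : ℝ × ℝ => α * p.1 + β * p.2) (fun _ => by fun_prop)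
  simp only [h1] at h3
  rw [← h3]
  rfl

end Gaussian

/-! ### Expectations over messages and noises -/

section Law

variable {M₁ M₂ n : ℕ}

instance [NeZero M₁] [NeZero M₂] : IsProbabilityMeasure (law M₁ M₂ n) := by
  have : ∀ M : ℕ, [NeZero M] → IsProbabilityMeasure (uniformOn (Set.univ : Set (Fin M))) :=
    fun M _ => isProbabilityMeasure_uniformOn Set.finite_univ Set.univ_nonempty
  unfold law; infer_instance

lemma lintegral_law {F : Outcome M₁ M₂ n → ℝ≥0∞} (hF : Measurable F) :
    ∫⁻ ω, F ω ∂law M₁ M₂ n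
      = (M₁ : ℝ≥0∞)⁻¹ * (M₂ : ℝ≥0∞)⁻¹ * ∑ w : Fin M₁ × Fin M₂,
        ∫⁻ z, F (w, z) ∂(noise n).prod ((noise n).prod (noise n)) := by
  have h : ∀ M : ℕ, ∀ a : Fin M, uniformOn (Set.univ : Set (Fin M)) {a} = (M : ℝ≥0∞)⁻¹ := by
    intro M a
    rw [uniformOn_univ, Measure.count_singleton]; simp
  rw [law, lintegral_prod _ hF.aemeasurable, lintegral_fintype, Finset.mul_sum]
  refine Finset.sum_congr rfl fun w _ => ?_
  rw [← Set.singleton_prod_singleton (a := w.1) (b := w.2), Measure.prod_prod, h, h, mul_comm]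

/-- Change of variables from noises to observations: given the messages `w`, the observations
are the noises shifted by `m w`. -/
lemma lintegral_law_shift {F : Outcome M₁ M₂ n → ℝ≥0∞} (hF : Measurable F)
    (m : Fin M₁ × Fin M₂ → (Fin n → ℝ) × (Fin n → ℝ) × (Fin n → ℝ)) :
    ∫⁻ ω, F ω ∂law M₁ M₂ n
      = (M₁ : ℝ≥0∞)⁻¹ * (M₂ : ℝ≥0∞)⁻¹ * ∑ w : Fin M₁ × Fin M₂,
        ∫⁻ y, ENNReal.ofReal (noiseDensity (y - m w)) * F (w, y - m w) := by
  rw [lintegral_law hF]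
  congr 1
  refine Finset.sum_congr rfl fun w _ => ?_
  rw [noise_prod_eq_withDensity, lintegral_withDensity_eq_lintegral_mul _ (by fun_prop)
    (by fun_prop)]
  have h : ((volume : Measure (Fin n → ℝ)).prod
      ((volume : Measure (Fin n → ℝ)).prod (volume : Measure (Fin n → ℝ)))).IsAddLeftInvariant :=
    Measure.prod.instIsAddLeftInvariant
  have : (volume : Measure ((Fin n → ℝ) × (Fin n → ℝ) × (Fin n → ℝ))).IsAddLeftInvariant := h
  exact (lintegral_sub_right_eq_self (fun z => ENNReal.ofReal (noiseDensity z) * F (w, z))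
    (m w)).symm

/-- A likelihood ratio has expectation at most one as soon as its numerator, summed over the
messages, is dominated by a probability density `G` of the observations. -/
lemma lintegral_law_le_one [NeZero M₁] [NeZero M₂] {r : Outcome M₁ M₂ n → ℝ} (hr : Measurable r)
    (hr0 : ∀ ω, 0 ≤ r ω)
    (m : Fin M₁ × Fin M₂ → (Fin n → ℝ) × (Fin n → ℝ) × (Fin n → ℝ))
    {G : (Fin n → ℝ) × (Fin n → ℝ) × (Fin n → ℝ) → ℝ}
    (hG : ∀ y, ∑ w, noiseDensity (y - m w) * r (w, y - m w) / (M₁ * M₂) ≤ G y)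
    (hG1 : ∫⁻ y, ENNReal.ofReal (G y) ≤ 1) :
    ∫⁻ ω, ENNReal.ofReal (r ω) ∂law M₁ M₂ n ≤ 1 := by
  have hM : (M₁ : ℝ≥0∞)⁻¹ * (M₂ : ℝ≥0∞)⁻¹ = ENNReal.ofReal ((M₁ * M₂ : ℝ)⁻¹) := by
    have h1 : (0 : ℝ) < M₁ := Nat.cast_pos.2 (NeZero.pos M₁)
    have h2 : (0 : ℝ) < M₂ := Nat.cast_pos.2 (NeZero.pos M₂)
    rw [mul_inv, ENNReal.ofReal_mul (by positivity), ENNReal.ofReal_inv_of_pos h1,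
      ENNReal.ofReal_inv_of_pos h2]
    simp
  rw [lintegral_law_shift (by fun_prop) m, ← lintegral_finsetSum _ (fun w _ => by fun_prop),
    ← lintegral_const_mul _ (by fun_prop)]
  refine (lintegral_mono fun y => ?_).trans hG1
  simp_rw [fun w => (ENNReal.ofReal_mul (q := r (w, y - m w)) (noiseDensity_nonneg (y - m w))).symm]
  rw [hM, ← ENNReal.ofReal_sum_of_nonneg
    (fun w _ => mul_nonneg (noiseDensity_nonneg _) (hr0 _)), ← ENNReal.ofReal_mul (by positivity)]
  refine ENNReal.ofReal_le_ofReal (le_trans (le_of_eq ?_) (hG y))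
  rw [Finset.mul_sum]
  refine Finset.sum_congr rfl fun w _ => ?_
  rw [div_eq_inv_mul]

/-- The energy of a linear combination of the noises with a message-dependent offset. -/
lemma integrable_integral_energy [NeZero M₁] [NeZero M₂] (a b c : ℝ)
    (d : Fin M₁ × Fin M₂ → Fin n → ℝ) :
    Integrable (fun ω : Outcome M₁ M₂ n =>
        ∑ k, (a * ω.2.1 k + b * ω.2.2.1 k + c * ω.2.2.2 k + d ω.1 k) ^ 2) (law M₁ M₂ n) ∧
      ∫ ω, ∑ k, (a * ω.2.1 k + b * ω.2.2.1 k + c * ω.2.2.2 k + d ω.1 k) ^ 2 ∂law M₁ M₂ n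
        = n * (a ^ 2 + b ^ 2 + c ^ 2) + (∑ w, ∑ k, d w k ^ 2) / (M₁ * M₂) := by
  have h1 : (0 : ℝ) < M₁ := Nat.cast_pos.2 (NeZero.pos M₁)
  have h2 : (0 : ℝ) < M₂ := Nat.cast_pos.2 (NeZero.pos M₂)
  have hd : Measurable d := Measurable.of_discrete
  have hmeas : Measurable fun ω : Outcome M₁ M₂ n =>
      ∑ k, (a * ω.2.1 k + b * ω.2.2.1 k + c * ω.2.2.2 k + d ω.1 k) ^ 2 := by
    refine Finset.measurable_sum _ fun k _ => ?_
    have : Measurable fun ω : Outcome M₁ M₂ n => d ω.1 k :=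
      (measurable_pi_apply k).comp (hd.comp measurable_fst)
    fun_prop
  have hnn : ∀ ω : Outcome M₁ M₂ n,
      0 ≤ ∑ k, (a * ω.2.1 k + b * ω.2.2.1 k + c * ω.2.2.2 k + d ω.1 k) ^ 2 :=
    fun ω => Finset.sum_nonneg fun k _ => sq_nonneg _
  have key : ∫⁻ ω, ENNReal.ofReal
      (∑ k, (a * ω.2.1 k + b * ω.2.2.1 k + c * ω.2.2.2 k + d ω.1 k) ^ 2) ∂law M₁ M₂ n
      = ENNReal.ofReal (n * (a ^ 2 + b ^ 2 + c ^ 2) + (∑ w, ∑ k, d w k ^ 2) / (M₁ * M₂)) := by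
    rw [lintegral_law (by fun_prop)]
    have hw : ∀ w : Fin M₁ × Fin M₂, ∫⁻ z, ENNReal.ofReal
        (∑ k, (a * z.1 k + b * z.2.1 k + c * z.2.2 k + d w k) ^ 2)
          ∂(noise n).prod ((noise n).prod (noise n))
        = ENNReal.ofReal (n * (a ^ 2 + b ^ 2 + c ^ 2) + ∑ k, d w k ^ 2) := by
      intro w
      simp_rw [fun z : (Fin n → ℝ) × (Fin n → ℝ) × (Fin n → ℝ) =>
        ENNReal.ofReal_sum_of_nonneg (s := Finset.univ)
          (f := fun k => (a * z.1 k + b * z.2.1 k + c * z.2.2 k + d w k) ^ 2)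
          (fun k _ => sq_nonneg _)]
      rw [lintegral_finsetSum _ (fun k _ => by fun_prop)]
      simp_rw [lintegral_sq_noise_prod]
      rw [← ENNReal.ofReal_sum_of_nonneg (fun k _ => by positivity), Finset.sum_add_distrib]
      simp only [Finset.sum_const, Finset.card_univ, Fintype.card_fin, nsmul_eq_mul]
    simp only [hw]
    rw [← ENNReal.ofReal_sum_of_nonneg (fun w _ => by positivity), ← ENNReal.ofReal_natCast M₁,
      ← ENNReal.ofReal_natCast M₂, ← ENNReal.ofReal_inv_of_pos h1, ← ENNReal.ofReal_inv_of_pos h2,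
      ← ENNReal.ofReal_mul (by positivity), ← ENNReal.ofReal_mul (by positivity),
      Finset.sum_add_distrib]
    congr 1
    simp only [Finset.sum_const, Finset.card_univ, Fintype.card_prod, Fintype.card_fin,
      nsmul_eq_mul, Nat.cast_mul]
    field_simp
  refine ⟨⟨hmeas.aestronglyMeasurable, ?_⟩, ?_⟩
  · rw [hasFiniteIntegral_iff_ofReal (ae_of_all _ hnn), key]
    exact ENNReal.ofReal_lt_top
  · rw [integral_eq_lintegral_of_nonneg_ae (ae_of_all _ hnn) hmeas.aestronglyMeasurable, key,
      ENNReal.toReal_ofReal (by positivity)]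

/-- Jensen's inequality in the form used for likelihood ratios: a function dominated by a sum of
deviations `r i - 1` of nonnegative variables with expectation at most one has nonpositive
expectation. -/
lemma integral_nonpos_of_le_sum_sub_one {Ω ι : Type*} [MeasurableSpace Ω] {μ : Measure Ω}
    [IsProbabilityMeasure μ] (s : Finset ι) {L : Ω → ℝ} {r : ι → Ω → ℝ} (hL : Integrable L μ)
    (hr : ∀ i, Measurable (r i)) (hr0 : ∀ i ω, 0 ≤ r i ω)
    (hr1 : ∀ i, ∫⁻ ω, ENNReal.ofReal (r i ω) ∂μ ≤ 1)
    (h : ∀ ω, L ω ≤ ∑ i ∈ s, (r i ω - 1)) : ∫ ω, L ω ∂μ ≤ 0 := by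
  have hint : ∀ i, Integrable (r i) μ := fun i =>
    ⟨(hr i).aestronglyMeasurable, by
      rw [hasFiniteIntegral_iff_ofReal (ae_of_all _ (hr0 i))]
      exact (hr1 i).trans_lt ENNReal.one_lt_top⟩
  have hle : ∀ i, ∫ ω, r i ω ∂μ ≤ 1 := fun i => by
    rw [integral_eq_lintegral_of_nonneg_ae (ae_of_all _ (hr0 i)) (hr i).aestronglyMeasurable]
    exact ENNReal.toReal_le_of_le_ofReal zero_le_one (by simpa using hr1 i)
  have hint' : ∀ i ∈ s, Integrable (fun ω => r i ω - 1) μ :=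
    fun i _ => (hint i).sub (integrable_const 1)
  refine (integral_mono hL (integrable_finsetSum s hint') h).trans ?_
  rw [integral_finsetSum s hint']
  refine Finset.sum_nonpos fun i _ => ?_
  rw [integral_sub (hint i) (integrable_const 1)]
  simpa using hle i

end Law

/-! ### Softened guesses -/

/-- The guess `D` of one out of `M` messages, softened by mixing it with a uniform guess. -/
noncomputable def softGuess {ι : Type*} [DecidableEq ι] [Fintype ι] (D w : ι) : ℝ :=
  (if D = w then 1 / 2 else 0) + 1 / (2 * Fintype.card ι)

section Fano

variable {ι : Type*} [DecidableEq ι] [Fintype ι]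

lemma softGuess_pos (D w : ι) : 0 < softGuess D w := by
  have : Nonempty ι := ⟨w⟩
  have : (0 : ℝ) < Fintype.card ι := Nat.cast_pos.2 Fintype.card_pos
  unfold softGuess
  split_ifs <;> positivity

lemma sum_softGuess (D : ι) : ∑ w, softGuess D w = 1 := by
  have : Nonempty ι := ⟨D⟩
  have : (0 : ℝ) < Fintype.card ι := Nat.cast_pos.2 Fintype.card_pos
  simp only [softGuess, Finset.sum_add_distrib, Finset.sum_ite_eq, Finset.mem_univ, if_true,
    Finset.sum_const, Finset.card_univ, nsmul_eq_mul]
  field_simp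
  norm_num

/-- The log-loss of a softened guess costs at most `log 2`, and all of `log M` only in case of an
error; this is Fano's inequality before taking expectations. -/
lemma le_log_card_mul_softGuess (D w : ι) :
    (if D = w then 1 else 0) * Real.log (Fintype.card ι) - Real.log 2
      ≤ Real.log (Fintype.card ι * softGuess D w) := by
  have : Nonempty ι := ⟨w⟩
  have : (0 : ℝ) < Fintype.card ι := Nat.cast_pos.2 Fintype.card_pos
  unfold softGuess
  split_ifs with h
  · rw [one_mul, ← Real.log_div this.ne' two_ne_zero]
    refine Real.log_le_log (by positivity) ?_
    have : (0:ℝ) ≤ Fintype.card ι * (1 / (2 * Fintype.card ι)) := by positivity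
    linarith
  · have e : (Fintype.card ι : ℝ) * (0 + 1 / (2 * Fintype.card ι)) = 2⁻¹ := by field_simp; simp
    rw [e, Real.log_inv]; simp

end Fano

/-! ### The multiple-access bound -/

section JointDecoding

variable {M₁ M₂ n : ℕ}

lemma measurable_of_forall_message {β : Type*} [MeasurableSpace β] {f : Outcome M₁ M₂ n → β}
    (h : ∀ w, Measurable fun z => f (w, z)) : Measurable f :=
  measurable_from_prod_countable_right h

/-- Log-ratio of a Gaussian reference density of variance `v` at `y` to the standard one at `z`. -/
lemma log_gaussDensity_sub_log {v : ℝ≥0} (hv : v ≠ 0) (y z : Fin n → ℝ) :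
    Real.log (gaussDensity v y) - Real.log (gaussDensity 1 z)
      = -(n / 2 * Real.log v) - (∑ k, y k ^ 2) / (2 * v) + (∑ k, z k ^ 2) / 2 := by
  have hv' : (0 : ℝ) < v := lt_of_le_of_ne v.2 (by exact_mod_cast hv.symm)
  rw [log_gaussDensity hv, log_gaussDensity one_ne_zero, Real.log_mul (by positivity) hv'.ne']
  simp
  ring

/-- The expected log-ratio of a Gaussian reference density of variance `v`, evaluated at a linear
combination `res` of the noises with message-dependent offset and energy at most `n v`, to the true
density of a unit noise block `ζ`. -/
lemma le_integral_log_gaussDensity_sub_log [NeZero M₁] [NeZero M₂] {v : ℝ≥0} (hv : v ≠ 0)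
    {res ζ : Outcome M₁ M₂ n → Fin n → ℝ} (a b c : ℝ) (d : Fin M₁ × Fin M₂ → Fin n → ℝ)
    (hres : ∀ ω k, res ω k = a * ω.2.1 k + b * ω.2.2.1 k + c * ω.2.2.2 k + d ω.1 k)
    (hd : n * (a ^ 2 + b ^ 2 + c ^ 2) + (∑ w, ∑ k, d w k ^ 2) / (M₁ * M₂) ≤ n * v)
    (a' b' c' : ℝ) (hζ : ∀ ω k, ζ ω k = a' * ω.2.1 k + b' * ω.2.2.1 k + c' * ω.2.2.2 k)
    (h' : a' ^ 2 + b' ^ 2 + c' ^ 2 = 1) :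
    Integrable (fun ω => Real.log (gaussDensity v (res ω)) - Real.log (gaussDensity 1 (ζ ω)))
        (law M₁ M₂ n) ∧
      -(n / 2 * Real.log v)
        ≤ ∫ ω, (Real.log (gaussDensity v (res ω)) - Real.log (gaussDensity 1 (ζ ω)))
            ∂law M₁ M₂ n := by
  have hv' : (0 : ℝ) < v := lt_of_le_of_ne v.2 (by exact_mod_cast hv.symm)
  obtain ⟨hf, hfe⟩ := integrable_integral_energy (M₁ := M₁) (M₂ := M₂) a b c d
  obtain ⟨hg, hge⟩ := integrable_integral_energy (M₁ := M₁) (M₂ := M₂) (n := n) a' b' c' 0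
  simp only [← hres] at hf hfe
  simp only [Pi.zero_apply, add_zero, ← hζ, h', mul_one, ne_eq, OfNat.ofNat_ne_zero,
    not_false_eq_true, zero_pow, Finset.sum_const_zero, zero_div] at hg hge
  simp only [log_gaussDensity_sub_log hv]
  have h1 : Integrable (fun ω => -(n / 2 * Real.log v) - (∑ k, res ω k ^ 2) / (2 * v))
      (law M₁ M₂ n) := (integrable_const _).sub (hf.div_const _)
  refine ⟨h1.add (hg.div_const _), ?_⟩
  rw [integral_add h1 (hg.div_const _), integral_sub (integrable_const _) (hf.div_const _),
    integral_div, integral_div, hge, hfe]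
  have : (n * (a ^ 2 + b ^ 2 + c ^ 2) + (∑ w, ∑ k, d w k ^ 2) / (M₁ * M₂)) / (2 * v)
      ≤ (n : ℝ) / 2 := by
    rw [div_le_iff₀ (by positivity)]
    linarith
  simp only [integral_const, probReal_univ, smul_eq_mul, one_mul]
  linarith

/-- Two independently chosen scalars, centred at their means: the energy of a linear combination
has no cross term. -/
lemma sum_sq_centered_le [NeZero M₁] [NeZero M₂] (a : Fin M₁ → ℝ) (b : Fin M₂ → ℝ) (g₁ g₂ : ℝ) :
    ∑ w : Fin M₁ × Fin M₂, (g₁ * (a w.1 - (∑ i, a i) / M₁) + g₂ * (b w.2 - (∑ i, b i) / M₂)) ^ 2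
      ≤ g₁ ^ 2 * (M₂ * ∑ i, a i ^ 2) + g₂ ^ 2 * (M₁ * ∑ i, b i ^ 2) := by
  have hzero : ∀ (M : ℕ) [NeZero M] (a : Fin M → ℝ), ∑ i, (a i - (∑ j, a j) / M) = 0 := by
    intro M _ a
    have : (M : ℝ) ≠ 0 := Nat.cast_ne_zero.2 (NeZero.ne M)
    rw [Finset.sum_sub_distrib]
    simp only [Finset.sum_const, Finset.card_univ, Fintype.card_fin, nsmul_eq_mul]
    field_simp
    simp
  have hsq : ∀ (M : ℕ) [NeZero M] (a : Fin M → ℝ),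
      ∑ i, (a i - (∑ j, a j) / M) ^ 2 ≤ ∑ i, a i ^ 2 := by
    intro M _ a
    set μ := (∑ j, a j) / M
    have e : ∑ i, a i ^ 2 = ∑ i, (a i - μ) ^ 2 + 2 * μ * ∑ i, (a i - μ) + ∑ _i : Fin M, μ ^ 2 := by
      rw [Finset.mul_sum, ← Finset.sum_add_distrib, ← Finset.sum_add_distrib]
      exact Finset.sum_congr rfl fun i _ => by ring
    rw [e, hzero M a]
    have : 0 ≤ ∑ _i : Fin M, μ ^ 2 := Finset.sum_nonneg fun _ _ => sq_nonneg _
    linarith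
  set p := fun i => a i - (∑ j, a j) / M₁
  set q := fun i => b i - (∑ j, b j) / M₂
  have e : ∑ w : Fin M₁ × Fin M₂, (g₁ * p w.1 + g₂ * q w.2) ^ 2
      = g₁ ^ 2 * (M₂ * ∑ i, p i ^ 2) + 2 * g₁ * g₂ * ((∑ i, p i) * ∑ i, q i)
        + g₂ ^ 2 * (M₁ * ∑ i, q i ^ 2) := by
    rw [Finset.sum_mul_sum, Fintype.sum_prod_type]
    simp only [add_sq, mul_pow, Finset.sum_add_distrib, Finset.mul_sum, Finset.sum_const,
      Finset.card_univ, Fintype.card_fin, nsmul_eq_mul]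
    congr 1
    · congr 1
      · exact Finset.sum_congr rfl fun i _ => by ring
      · exact Finset.sum_congr rfl fun i _ => Finset.sum_congr rfl fun j _ => by ring
    · exact Finset.sum_congr rfl fun i _ => by ring
  rw [e, hzero M₁ a]
  have h1 := mul_le_mul_of_nonneg_left (hsq M₁ a) (Nat.cast_nonneg M₂ : (0 : ℝ) ≤ M₂)
  have h2 := mul_le_mul_of_nonneg_left (hsq M₂ b) (Nat.cast_nonneg M₁ : (0 : ℝ) ≤ M₁)
  have h3 := mul_le_mul_of_nonneg_left h1 (sq_nonneg g₁)
  have h4 := mul_le_mul_of_nonneg_left h2 (sq_nonneg g₂)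
  linarith

lemma integral_indicator_mul_sub_log_two {Ω : Type*} [MeasurableSpace Ω] {μ : Measure Ω}
    [IsProbabilityMeasure μ] {S : Set Ω} (hS : MeasurableSet S) (a : ℝ) :
    Integrable (fun ω => S.indicator (1 : Ω → ℝ) ω * a - Real.log 2) μ ∧
      ∫ ω, (S.indicator (1 : Ω → ℝ) ω * a - Real.log 2) ∂μ = μ.real S * a - Real.log 2 := by
  have h : Integrable (fun ω => S.indicator (1 : Ω → ℝ) ω * a) μ :=
    ((integrable_const 1).indicator hS).mul_const _
  refine ⟨h.sub (integrable_const _), ?_⟩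
  rw [integral_sub h (integrable_const _), integral_mul_const, integral_indicator_one hS,
    integral_const, probReal_univ, one_smul]

/-- The likelihood ratio behind Fano's inequality when both messages are estimated from the
observations `z + m w`, with a reference density `G` in place of their true density. -/
lemma lintegral_joint_ratio_le_one [NeZero M₁] [NeZero M₂]
    (m : Fin M₁ × Fin M₂ → (Fin n → ℝ) × (Fin n → ℝ) × (Fin n → ℝ))
    {D : (Fin n → ℝ) × (Fin n → ℝ) × (Fin n → ℝ) → Fin M₁ × Fin M₂} (hD : Measurable D)
    {G : (Fin n → ℝ) × (Fin n → ℝ) × (Fin n → ℝ) → ℝ} (hG : Measurable G)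
    (hG0 : ∀ y, 0 ≤ G y) (hG1 : ∫⁻ y, ENNReal.ofReal (G y) ≤ 1) :
    let r : Outcome M₁ M₂ n → ℝ := fun ω => M₁ * M₂ * softGuess (D (ω.2 + m ω.1)) ω.1
      * G (ω.2 + m ω.1) / noiseDensity ω.2
    Measurable r ∧ (∀ ω, 0 ≤ r ω) ∧ ∫⁻ ω, ENNReal.ofReal (r ω) ∂law M₁ M₂ n ≤ 1 := by
  intro r
  have hr : Measurable r := by
    refine measurable_of_forall_message fun w => ?_
    have h1 : Measurable fun z : (Fin n → ℝ) × (Fin n → ℝ) × (Fin n → ℝ) =>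
        softGuess (D (z + m w)) w :=
      (Measurable.of_discrete (f := fun u => softGuess u w)).comp
        (hD.comp (measurable_id.add_const _))
    have h2 : Measurable fun z : (Fin n → ℝ) × (Fin n → ℝ) × (Fin n → ℝ) => G (z + m w) :=
      hG.comp (measurable_id.add_const _)
    exact ((h1.const_mul _).mul h2).div measurable_noiseDensity
  have hr0 : ∀ ω, 0 ≤ r ω := fun ω =>
    div_nonneg (mul_nonneg (mul_nonneg (by positivity) (softGuess_pos _ _).le) (hG0 _))
      (noiseDensity_nonneg _)
  refine ⟨hr, hr0, lintegral_law_le_one hr hr0 m (fun y => le_of_eq ?_) hG1⟩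
  have h1 : (M₁ : ℝ) ≠ 0 := Nat.cast_ne_zero.2 (NeZero.ne M₁)
  have h2 : (M₂ : ℝ) ≠ 0 := Nat.cast_ne_zero.2 (NeZero.ne M₂)
  have hpos : ∀ z : (Fin n → ℝ) × (Fin n → ℝ) × (Fin n → ℝ), noiseDensity z ≠ 0 := fun z =>
    (mul_pos (gaussDensity_pos one_ne_zero _)
      (mul_pos (gaussDensity_pos one_ne_zero _) (gaussDensity_pos one_ne_zero _))).ne'
  calc ∑ w, noiseDensity (y - m w) * r (w, y - m w) / (M₁ * M₂)
      = ∑ w, softGuess (D y) w * G y := by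
        refine Finset.sum_congr rfl fun w _ => ?_
        have := hpos (y - m w)
        simp only [r, sub_add_cancel]
        field_simp
    _ = G y := by rw [← Finset.sum_mul, sum_softGuess, one_mul]

/-- The multiple-access bound: if one receiver with unit noise estimates both messages from
`g₁ x₁ + g₂ x₂ + z`, the relay's observation and an extra independent noise block, then its
probability of success limits the number of message pairs. -/
theorem joint_decoding_bound [NeZero M₁] [NeZero M₂] {x₁ : Fin M₁ → Fin n → ℝ}
    {x₂ : Fin M₂ → Fin n → ℝ} {P : ℝ} (hP : 0 ≤ P) (g₁ g₂ h : ℝ)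
    (h₁ : ∑ w, ∑ k, x₁ w k ^ 2 ≤ M₁ * (n * P)) (h₂ : ∑ w, ∑ k, x₂ w k ^ 2 ≤ M₂ * (n * P))
    {m : Fin M₁ × Fin M₂ → (Fin n → ℝ) × (Fin n → ℝ) × (Fin n → ℝ)}
    (hm : ∀ w, m w = (g₁ • x₁ w.1 + g₂ • x₂ w.2, 0, h • x₁ w.1 + h • x₂ w.2))
    {D : (Fin n → ℝ) × (Fin n → ℝ) × (Fin n → ℝ) → Fin M₁ × Fin M₂} (hD : Measurable D) :
    (law M₁ M₂ n).real {ω | D (ω.2 + m ω.1) = ω.1} * Real.log (M₁ * M₂) - Real.log 2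
      ≤ n / 2 * Real.log (1 + (g₁ ^ 2 + g₂ ^ 2) * P) + n / 2 * Real.log (1 + 2 * h ^ 2 * P) := by
  have hM₁ : (0 : ℝ) < M₁ := Nat.cast_pos.2 (NeZero.pos M₁)
  have hM₂ : (0 : ℝ) < M₂ := Nat.cast_pos.2 (NeZero.pos M₂)
  -- The reference density is Gaussian, centred at the mean of the observations.
  set μ₁ : Fin n → ℝ := fun k => (∑ i, x₁ i k) / M₁ with hμ₁
  set μ₂ : Fin n → ℝ := fun k => (∑ i, x₂ i k) / M₂ with hμ₂
  have hv₀ : ∀ a b : ℝ, 0 < 1 + (a ^ 2 + b ^ 2) * P := fun a b => by positivity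
  obtain ⟨v₁, hv₁⟩ : ∃ v : ℝ≥0, (v : ℝ) = 1 + (g₁ ^ 2 + g₂ ^ 2) * P := ⟨⟨_, (hv₀ _ _).le⟩, rfl⟩
  obtain ⟨v₂, hv₂⟩ : ∃ v : ℝ≥0, (v : ℝ) = 1 + (h ^ 2 + h ^ 2) * P := ⟨⟨_, (hv₀ _ _).le⟩, rfl⟩
  have hv₁p : (0 : ℝ) < v₁ := hv₁ ▸ hv₀ _ _
  have hv₂p : (0 : ℝ) < v₂ := hv₂ ▸ hv₀ _ _
  have hv₁0 : v₁ ≠ 0 := by exact_mod_cast hv₁p.ne'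
  have hv₂0 : v₂ ≠ 0 := by exact_mod_cast hv₂p.ne'
  set ν₁ := g₁ • μ₁ + g₂ • μ₂ with hν₁
  set ν₂ := h • μ₁ + h • μ₂ with hν₂
  set G : (Fin n → ℝ) × (Fin n → ℝ) × (Fin n → ℝ) → ℝ := fun y =>
    gaussDensity v₁ (y.1 - ν₁) * (gaussDensity 1 (y.2.1 - 0) * gaussDensity v₂ (y.2.2 - ν₂))
    with hGdef
  have hGm : Measurable G := by fun_prop
  have hG0 : ∀ y, 0 ≤ G y := fun y => mul_nonneg (gaussDensity_nonneg _)
    (mul_nonneg (gaussDensity_nonneg _) (gaussDensity_nonneg _))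
  have hG1 : ∫⁻ y, ENNReal.ofReal (G y) ≤ 1 := by
    simp only [hGdef, ENNReal.ofReal_mul (gaussDensity_nonneg _)]
    rw [Measure.volume_eq_prod, lintegral_prod_mul (f := fun y : Fin n → ℝ =>
        ENNReal.ofReal (gaussDensity v₁ (y - ν₁)))
        (g := fun y : (Fin n → ℝ) × (Fin n → ℝ) => ENNReal.ofReal (gaussDensity 1 (y.1 - 0))
          * ENNReal.ofReal (gaussDensity v₂ (y.2 - ν₂))) (by fun_prop) (by fun_prop),
      Measure.volume_eq_prod, lintegral_prod_mul (f := fun y : Fin n → ℝ =>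
        ENNReal.ofReal (gaussDensity 1 (y - 0)))
        (g := fun y => ENNReal.ofReal (gaussDensity v₂ (y - ν₂))) (by fun_prop) (by fun_prop),
      lintegral_gaussDensity_sub hv₁0, lintegral_gaussDensity_sub one_ne_zero,
      lintegral_gaussDensity_sub hv₂0]
    simp
  obtain ⟨hr, hr0, hr1⟩ := lintegral_joint_ratio_le_one m hD hGm hG0 hG1
  set r : Outcome M₁ M₂ n → ℝ := fun ω => M₁ * M₂ * softGuess (D (ω.2 + m ω.1)) ω.1
      * G (ω.2 + m ω.1) / noiseDensity ω.2
  set S : Set (Outcome M₁ M₂ n) := {ω | D (ω.2 + m ω.1) = ω.1}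
  have hS : MeasurableSet S := by
    refine measurableSet_eq_fun (hD.comp ?_) measurable_fst
    exact measurable_of_forall_message fun w => measurable_id.add_const (m w)
  -- Energies of the two centred observations and of the two noises.
  have hd : ∀ g g' : ℝ, (∑ w : Fin M₁ × Fin M₂, ∑ k,
      (g * (x₁ w.1 k - μ₁ k) + g' * (x₂ w.2 k - μ₂ k)) ^ 2) / (M₁ * M₂)
      ≤ n * ((g ^ 2 + g' ^ 2) * P) := by
    intro g g'
    rw [div_le_iff₀ (by positivity), Finset.sum_comm]
    refine (Finset.sum_le_sum fun k _ =>
      sum_sq_centered_le (fun i => x₁ i k) (fun i => x₂ i k) g g').trans ?_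
    rw [Finset.sum_add_distrib, ← Finset.mul_sum, ← Finset.mul_sum, ← Finset.mul_sum,
      ← Finset.mul_sum, Finset.sum_comm, Finset.sum_comm (s := Finset.univ (α := Fin n))]
    have e1 := mul_le_mul_of_nonneg_left h₁ (mul_nonneg (sq_nonneg g) hM₂.le)
    have e2 := mul_le_mul_of_nonneg_left h₂ (mul_nonneg (sq_nonneg g') hM₁.le)
    linarith
  obtain ⟨k1, l1⟩ := le_integral_log_gaussDensity_sub_log (M₁ := M₁) (M₂ := M₂) hv₁0
    (res := fun ω => (ω.2 + m ω.1).1 - ν₁) (ζ := fun ω => ω.2.1) 1 0 0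
    (fun w k => g₁ * (x₁ w.1 k - μ₁ k) + g₂ * (x₂ w.2 k - μ₂ k))
    (by intro ω k; simp [hm, hν₁]; ring) (by rw [hv₁]; linarith [hd g₁ g₂]) 1 0 0
    (by intro ω k; simp) (by norm_num)
  obtain ⟨k2, l2⟩ := le_integral_log_gaussDensity_sub_log (M₁ := M₁) (M₂ := M₂) hv₂0
    (res := fun ω => (ω.2 + m ω.1).2.2 - ν₂) (ζ := fun ω => ω.2.2.2) 0 0 1
    (fun w k => h * (x₁ w.1 k - μ₁ k) + h * (x₂ w.2 k - μ₂ k))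
    (by intro ω k; simp [hm, hν₂]; ring) (by rw [hv₂]; linarith [hd h h]) 0 0 1
    (by intro ω k; simp) (by norm_num)
  obtain ⟨k3, l3⟩ := integral_indicator_mul_sub_log_two (μ := law M₁ M₂ n) hS
    (Real.log (M₁ * M₂))
  have key := integral_nonpos_of_le_sum_sub_one (Finset.univ (α := Unit)) (r := fun _ => r)
    ((k3.add k1).add k2) (fun _ => hr) (fun _ => hr0) (fun _ => hr1) (fun ω => by
      have p1 := gaussDensity_pos hv₁0 ((ω.2 + m ω.1).1 - ν₁)
      have p2 := gaussDensity_pos hv₂0 ((ω.2 + m ω.1).2.2 - ν₂)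
      have p3 := gaussDensity_pos one_ne_zero ω.2.1
      have p4 := gaussDensity_pos one_ne_zero ω.2.2.1
      have p5 := gaussDensity_pos one_ne_zero ω.2.2.2
      have p6 := softGuess_pos (D (ω.2 + m ω.1)) ω.1
      have hY : (ω.2 + m ω.1).2.1 = ω.2.2.1 := by simp [hm]
      have hrω : r ω = (M₁ * M₂ * softGuess (D (ω.2 + m ω.1)) ω.1)
          * (gaussDensity v₁ ((ω.2 + m ω.1).1 - ν₁) / gaussDensity 1 ω.2.1)
          * (gaussDensity v₂ ((ω.2 + m ω.1).2.2 - ν₂) / gaussDensity 1 ω.2.2.2) := by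
        simp only [r, hGdef, noiseDensity, hY, sub_zero]
        field_simp
      have hlog := Real.log_le_sub_one_of_pos (x := r ω) (by rw [hrω]; positivity)
      have hq := le_log_card_mul_softGuess (D (ω.2 + m ω.1)) ω.1
      rw [hrω, Real.log_mul (by positivity) (by positivity),
        Real.log_mul (by positivity) (by positivity), Real.log_div p1.ne' p3.ne',
        Real.log_div p2.ne' p5.ne', ← hrω] at hlog
      simp only [Fintype.card_prod, Fintype.card_fin, Nat.cast_mul] at hq
      have hind : S.indicator (1 : Outcome M₁ M₂ n → ℝ) ω
          = if D (ω.2 + m ω.1) = ω.1 then 1 else 0 := by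
        simp [Set.indicator_apply, S]
      simp only [Pi.add_apply, Finset.univ_unique, Finset.sum_singleton, hind]
      linarith)
  rw [integral_add' (k3.add k1) k2, integral_add' k3 k1, l3] at key
  rw [hv₁] at l1
  have e : (h ^ 2 + h ^ 2) * P = 2 * h ^ 2 * P := by ring
  rw [hv₂, e] at l2
  linarith

end JointDecoding

/-! ### Likelihood ratios for the genie-aided receivers -/

section Genie

variable {M M₁ M₂ n : ℕ}

/-- The joint density of `c x + z` and `h x + z'` when the codeword `x` is chosen uniformly, `z` is
standard Gaussian noise and `z'` is Gaussian noise of variance `v`. -/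
noncomputable def mixDensity (x : Fin M → Fin n → ℝ) (c h : ℝ) (v : ℝ≥0) (t y : Fin n → ℝ) : ℝ :=
  (∑ w, gaussDensity 1 (t - c • x w) * gaussDensity v (y - h • x w)) / M

lemma mixDensity_nonneg (x : Fin M → Fin n → ℝ) (c h : ℝ) (v : ℝ≥0) (t y : Fin n → ℝ) :
    0 ≤ mixDensity x c h v t y :=
  div_nonneg (Finset.sum_nonneg fun _ _ => mul_nonneg (gaussDensity_nonneg _)
    (gaussDensity_nonneg _)) (Nat.cast_nonneg M)

lemma mixDensity_pos [NeZero M] (x : Fin M → Fin n → ℝ) (c h : ℝ) {v : ℝ≥0} (hv : v ≠ 0)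
    (t y : Fin n → ℝ) : 0 < mixDensity x c h v t y :=
  div_pos (Finset.sum_pos (fun _ _ => mul_pos (gaussDensity_pos one_ne_zero _)
    (gaussDensity_pos hv _)) Finset.univ_nonempty) (Nat.cast_pos.2 (NeZero.pos M))

@[fun_prop]
lemma measurable_mixDensity {Ω : Type*} [MeasurableSpace Ω] (x : Fin M → Fin n → ℝ) (c h : ℝ)
    (v : ℝ≥0) {f g : Ω → Fin n → ℝ} (hf : Measurable f) (hg : Measurable g) :
    Measurable fun ω => mixDensity x c h v (f ω) (g ω) := by
  unfold mixDensity; fun_prop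

lemma lintegral_mixDensity [NeZero M] (x : Fin M → Fin n → ℝ) (c h : ℝ) {v : ℝ≥0} (hv : v ≠ 0)
    (a : Fin n → ℝ) :
    ∫⁻ p : (Fin n → ℝ) × (Fin n → ℝ), ENNReal.ofReal (mixDensity x c h v p.1 (p.2 - a)) = 1 := by
  have hM : (0 : ℝ) < M := Nat.cast_pos.2 (NeZero.pos M)
  have e : ∀ p : (Fin n → ℝ) × (Fin n → ℝ), ENNReal.ofReal (mixDensity x c h v p.1 (p.2 - a))
      = (∑ w, ENNReal.ofReal (gaussDensity 1 (p.1 - c • x w))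
          * ENNReal.ofReal (gaussDensity v (p.2 - (a + h • x w)))) * (M : ℝ≥0∞)⁻¹ := by
    intro p
    rw [mixDensity, ENNReal.ofReal_div_of_pos hM, ENNReal.ofReal_sum_of_nonneg
      (fun _ _ => mul_nonneg (gaussDensity_nonneg _) (gaussDensity_nonneg _)), ENNReal.ofReal_natCast,
      div_eq_mul_inv]
    simp only [ENNReal.ofReal_mul (gaussDensity_nonneg _), sub_sub]
  simp_rw [e]
  rw [lintegral_mul_const _ (by fun_prop), lintegral_finsetSum _ (fun w _ => by fun_prop),
    Measure.volume_eq_prod]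
  simp_rw [fun w => lintegral_prod_mul (μ := (volume : Measure (Fin n → ℝ)))
    (ν := (volume : Measure (Fin n → ℝ)))
    (f := fun t => ENNReal.ofReal (gaussDensity 1 (t - c • x w)))
    (g := fun y => ENNReal.ofReal (gaussDensity v (y - (a + h • x w)))) (by fun_prop) (by fun_prop),
    lintegral_gaussDensity_sub hv, lintegral_gaussDensity_sub one_ne_zero]
  simp only [mul_one, Finset.sum_const, Finset.card_univ, Fintype.card_fin, nsmul_eq_mul]
  exact ENNReal.mul_inv_cancel (Nat.cast_ne_zero.2 (NeZero.ne M)) (ENNReal.natCast_ne_top M)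

/-- What receiver 1 sees, once the relay's signal is removed, together with its side information:
`hd x₁ + hc x₂ + z₁`, the genie signal `hc x₁ + z₂`, and the relay's observation. Only the
noiseless part is recorded. -/
def genieMean (hd hc h : ℝ) (x₁ : Fin M₁ → Fin n → ℝ) (x₂ : Fin M₂ → Fin n → ℝ)
    (w : Fin M₁ × Fin M₂) : (Fin n → ℝ) × (Fin n → ℝ) × (Fin n → ℝ) :=
  (hd • x₁ w.1 + hc • x₂ w.2, hc • x₁ w.1, h • x₁ w.1 + h • x₂ w.2)

/-- The likelihood ratio behind Fano's inequality for receiver 1 with the genie signal: a softened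
guess of the message and a reference density of the observations in the numerator, the density of
the observations given the message of transmitter 1 in the denominator. The reference density takes
the receiver's signal to be Gaussian around its affine estimate from the side information. -/
noncomputable def fanoRatio (hd hc h : ℝ) (s v : ℝ≥0) (x₁ : Fin M₁ → Fin n → ℝ)
    (x₂ : Fin M₂ → Fin n → ℝ) (D : (Fin n → ℝ) × (Fin n → ℝ) × (Fin n → ℝ) → Fin M₁)
    (w : Fin M₁ × Fin M₂) (y : (Fin n → ℝ) × (Fin n → ℝ) × (Fin n → ℝ)) : ℝ :=
  M₁ * softGuess (D y) w.1 * (gaussDensity s (y.1 - ((hc / h) • y.2.2 - (1 - hd / hc) • y.2.1))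
    * mixDensity x₁ hc h v y.2.1 y.2.2)
    / (gaussDensity 1 (y.2.1 - hc • x₁ w.1)
      * mixDensity x₂ hc h 1 (y.1 - hd • x₁ w.1) (y.2.2 - h • x₁ w.1))

/-- The likelihood ratio that bounds what the genie signal and the relay's observation together
reveal about the message of transmitter 2. -/
noncomputable def relayRatio (hc h : ℝ) (v : ℝ≥0) (x₁ : Fin M₁ → Fin n → ℝ)
    (x₂ : Fin M₂ → Fin n → ℝ) (w : Fin M₁ × Fin M₂)
    (y : (Fin n → ℝ) × (Fin n → ℝ) × (Fin n → ℝ)) : ℝ :=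
  mixDensity x₁ hc h 1 y.2.1 (y.2.2 - h • x₂ w.2) * gaussDensity v (y.2.2 - h • x₁ w.1)
    / (mixDensity x₁ hc h v y.2.1 y.2.2 * gaussDensity 1 (y.2.2 - (h • x₁ w.1 + h • x₂ w.2)))

variable [NeZero M₁] (hd hc h : ℝ) {s v : ℝ≥0}
  (x₁ : Fin M₁ → Fin n → ℝ) (x₂ : Fin M₂ → Fin n → ℝ)
  {D : (Fin n → ℝ) × (Fin n → ℝ) × (Fin n → ℝ) → Fin M₁}

lemma log_relayRatio_le (hv : v ≠ 0) (w : Fin M₁ × Fin M₂)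
    (y : (Fin n → ℝ) × (Fin n → ℝ) × (Fin n → ℝ)) :
    Real.log (mixDensity x₁ hc h 1 y.2.1 (y.2.2 - h • x₂ w.2))
      + Real.log (gaussDensity v (y.2.2 - h • x₁ w.1))
      - Real.log (mixDensity x₁ hc h v y.2.1 y.2.2)
      - Real.log (gaussDensity 1 (y.2.2 - (h • x₁ w.1 + h • x₂ w.2)))
      ≤ relayRatio hc h v x₁ x₂ w y - 1 := by
  have p1 := mixDensity_pos x₁ hc h one_ne_zero y.2.1 (y.2.2 - h • x₂ w.2)
  have p2 := gaussDensity_pos hv (y.2.2 - h • x₁ w.1)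
  have p3 := mixDensity_pos x₁ hc h hv y.2.1 y.2.2
  have p4 := gaussDensity_pos one_ne_zero (y.2.2 - (h • x₁ w.1 + h • x₂ w.2))
  refine le_trans (le_of_eq ?_)
    (Real.log_le_sub_one_of_pos (div_pos (mul_pos p1 p2) (mul_pos p3 p4)))
  rw [relayRatio, Real.log_div (by positivity) (by positivity), Real.log_mul p1.ne' p2.ne',
    Real.log_mul p3.ne' p4.ne']
  ring

variable [NeZero M₂]

lemma log_fanoRatio_le (hs : s ≠ 0) (hv : v ≠ 0) (w : Fin M₁ × Fin M₂)
    (y : (Fin n → ℝ) × (Fin n → ℝ) × (Fin n → ℝ)) :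
    Real.log (M₁ * softGuess (D y) w.1)
      + Real.log (gaussDensity s (y.1 - ((hc / h) • y.2.2 - (1 - hd / hc) • y.2.1)))
      + Real.log (mixDensity x₁ hc h v y.2.1 y.2.2)
      - Real.log (gaussDensity 1 (y.2.1 - hc • x₁ w.1))
      - Real.log (mixDensity x₂ hc h 1 (y.1 - hd • x₁ w.1) (y.2.2 - h • x₁ w.1))
      ≤ fanoRatio hd hc h s v x₁ x₂ D w y - 1 := by
  have hM₁ : (0 : ℝ) < M₁ := Nat.cast_pos.2 (NeZero.pos M₁)
  have p1 := softGuess_pos (D y) w.1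
  have p2 := gaussDensity_pos hs (y.1 - ((hc / h) • y.2.2 - (1 - hd / hc) • y.2.1))
  have p3 := mixDensity_pos x₁ hc h hv y.2.1 y.2.2
  have p4 := gaussDensity_pos one_ne_zero (y.2.1 - hc • x₁ w.1)
  have p5 := mixDensity_pos x₂ hc h one_ne_zero (y.1 - hd • x₁ w.1) (y.2.2 - h • x₁ w.1)
  refine le_trans (le_of_eq ?_)
    (Real.log_le_sub_one_of_pos (div_pos (mul_pos (mul_pos hM₁ p1) (mul_pos p2 p3)) (mul_pos p4 p5)))
  rw [fanoRatio, Real.log_div (by positivity) (by positivity), Real.log_mul (mul_pos hM₁ p1).ne' (mul_pos p2 p3).ne',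
    Real.log_mul p2.ne' p3.ne', Real.log_mul p4.ne' p5.ne']
  ring

lemma fanoRatio_lintegral_le_one (hs : s ≠ 0) (hv : v ≠ 0) (hD : Measurable D) :
    let r : Outcome M₁ M₂ n → ℝ := fun ω =>
      fanoRatio hd hc h s v x₁ x₂ D ω.1 (ω.2 + genieMean hd hc h x₁ x₂ ω.1)
    Measurable r ∧ (∀ ω, 0 ≤ r ω) ∧ ∫⁻ ω, ENNReal.ofReal (r ω) ∂law M₁ M₂ n ≤ 1 := by
  intro r
  have hr : Measurable r := by
    refine measurable_of_forall_message fun w => ?_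
    have h1 : ∀ i, Measurable fun y : (Fin n → ℝ) × (Fin n → ℝ) × (Fin n → ℝ) =>
        softGuess (D y) i := fun i => (Measurable.of_discrete (f := fun u => softGuess u i)).comp hD
    have h2 : Measurable (fanoRatio hd hc h s v x₁ x₂ D w) := by
      unfold fanoRatio; fun_prop
    exact h2.comp (measurable_id.add_const (genieMean hd hc h x₁ x₂ w))
  have hr0 : ∀ ω, 0 ≤ r ω := fun ω => by
    refine div_nonneg (mul_nonneg (mul_nonneg (Nat.cast_nonneg _) (softGuess_pos _ _).le)
      (mul_nonneg (gaussDensity_nonneg _) (mixDensity_nonneg ..)))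
      (mul_nonneg (gaussDensity_nonneg _) (mixDensity_nonneg ..))
  refine ⟨hr, hr0, lintegral_law_le_one hr hr0 (genieMean hd hc h x₁ x₂)
    (G := fun y => gaussDensity s (y.1 - ((hc / h) • y.2.2 - (1 - hd / hc) • y.2.1))
      * mixDensity x₁ hc h v y.2.1 (y.2.2 - 0)) (fun y => le_of_eq ?_) ?_⟩
  · have hM₁ : (M₁ : ℝ) ≠ 0 := Nat.cast_ne_zero.2 (NeZero.ne M₁)
    have hM₂ : (M₂ : ℝ) ≠ 0 := Nat.cast_ne_zero.2 (NeZero.ne M₂)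
    simp only [r, sub_add_cancel, sub_zero]
    set Q := gaussDensity s (y.1 - ((hc / h) • y.2.2 - (1 - hd / hc) • y.2.1))
      * mixDensity x₁ hc h v y.2.1 y.2.2 with hQ
    rw [Fintype.sum_prod_type]
    -- The sum over the message of transmitter 2 cancels the mixture in the denominator.
    have key : ∀ i : Fin M₁, ∑ j : Fin M₂, noiseDensity (y - genieMean hd hc h x₁ x₂ (i, j))
        * fanoRatio hd hc h s v x₁ x₂ D (i, j) y / (M₁ * M₂) = softGuess (D y) i * Q := by
      intro i
      have p1 := (gaussDensity_pos one_ne_zero (y.2.1 - hc • x₁ i)).ne'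
      have p2 := (mixDensity_pos x₂ hc h one_ne_zero (y.1 - hd • x₁ i) (y.2.2 - h • x₁ i)).ne'
      have hterm : ∀ j : Fin M₂, noiseDensity (y - genieMean hd hc h x₁ x₂ (i, j))
          * fanoRatio hd hc h s v x₁ x₂ D (i, j) y / (M₁ * M₂)
          = softGuess (D y) i * Q / mixDensity x₂ hc h 1 (y.1 - hd • x₁ i) (y.2.2 - h • x₁ i) / M₂
            * (gaussDensity 1 (y.1 - hd • x₁ i - hc • x₂ j)
              * gaussDensity 1 (y.2.2 - h • x₁ i - h • x₂ j)) := by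
        intro j
        simp only [noiseDensity, genieMean, fanoRatio, Prod.fst_sub, Prod.snd_sub, ← hQ, sub_sub]
        field_simp
      simp only [hterm]
      rw [← Finset.mul_sum, show ∑ j : Fin M₂, gaussDensity 1 (y.1 - hd • x₁ i - hc • x₂ j)
        * gaussDensity 1 (y.2.2 - h • x₁ i - h • x₂ j)
        = M₂ * mixDensity x₂ hc h 1 (y.1 - hd • x₁ i) (y.2.2 - h • x₁ i) by
          rw [mixDensity]; field_simp]
      field_simp
    simp only [key]
    rw [← Finset.sum_mul, sum_softGuess, one_mul]
  · rw [Measure.volume_eq_prod, lintegral_prod_symm _ (by fun_prop)]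
    simp only [ENNReal.ofReal_mul (gaussDensity_nonneg _)]
    have e : ∀ p : (Fin n → ℝ) × (Fin n → ℝ), ∫⁻ t : Fin n → ℝ,
        ENNReal.ofReal (gaussDensity s (t - ((hc / h) • p.2 - (1 - hd / hc) • p.1)))
          * ENNReal.ofReal (mixDensity x₁ hc h v p.1 (p.2 - 0))
        = ENNReal.ofReal (mixDensity x₁ hc h v p.1 (p.2 - 0)) := by
      intro p
      rw [lintegral_mul_const _ (by fun_prop), lintegral_gaussDensity_sub hs, one_mul]
    simp only [e]
    exact (lintegral_mixDensity x₁ hc h hv 0).le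

lemma relayRatio_lintegral_le_one (hv : v ≠ 0) :
    let r : Outcome M₁ M₂ n → ℝ := fun ω =>
      relayRatio hc h v x₁ x₂ ω.1 (ω.2 + genieMean hd hc h x₁ x₂ ω.1)
    Measurable r ∧ (∀ ω, 0 ≤ r ω) ∧ ∫⁻ ω, ENNReal.ofReal (r ω) ∂law M₁ M₂ n ≤ 1 := by
  intro r
  have hr : Measurable r := by
    refine measurable_of_forall_message fun w => ?_
    have h2 : Measurable (relayRatio hc h v x₁ x₂ w) := by
      unfold relayRatio; fun_prop
    exact h2.comp (measurable_id.add_const (genieMean hd hc h x₁ x₂ w))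
  have hr0 : ∀ ω, 0 ≤ r ω := fun ω =>
    div_nonneg (mul_nonneg (mixDensity_nonneg ..) (gaussDensity_nonneg _))
      (mul_nonneg (mixDensity_nonneg ..) (gaussDensity_nonneg _))
  -- The signal of the receiver plays no role here, so its mean may be taken to vanish.
  have hr' : ∀ ω, r ω = relayRatio hc h v x₁ x₂ ω.1
      (ω.2 + ((0, (genieMean hd hc h x₁ x₂ ω.1).2) : (Fin n → ℝ) × (Fin n → ℝ) × (Fin n → ℝ))) :=
    fun ω => rfl
  refine ⟨hr, hr0, lintegral_law_le_one hr hr0 (fun w => (0, (genieMean hd hc h x₁ x₂ w).2))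
    (G := fun y => gaussDensity 1 (y.1 - 0)
      * ((∑ j, mixDensity x₁ hc h 1 y.2.1 (y.2.2 - h • x₂ j)) / M₂)) (fun y => le_of_eq ?_) ?_⟩
  · have hM₁ : (M₁ : ℝ) ≠ 0 := Nat.cast_ne_zero.2 (NeZero.ne M₁)
    have hM₂ : (M₂ : ℝ) ≠ 0 := Nat.cast_ne_zero.2 (NeZero.ne M₂)
    simp only [hr', sub_add_cancel]
    rw [Fintype.sum_prod_type, Finset.sum_comm, Finset.sum_div, Finset.mul_sum]
    refine Finset.sum_congr rfl fun j _ => ?_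
    have p1 := (mixDensity_pos x₁ hc h hv y.2.1 y.2.2).ne'
    have hterm : ∀ i : Fin M₁, noiseDensity (y - (0, (genieMean hd hc h x₁ x₂ (i, j)).2))
        * relayRatio hc h v x₁ x₂ (i, j) y / (M₁ * M₂)
        = gaussDensity 1 (y.1 - 0) * mixDensity x₁ hc h 1 y.2.1 (y.2.2 - h • x₂ j)
          / mixDensity x₁ hc h v y.2.1 y.2.2 / (M₁ * M₂)
          * (gaussDensity 1 (y.2.1 - hc • x₁ i) * gaussDensity v (y.2.2 - h • x₁ i)) := by
      intro i
      have p2 := (gaussDensity_pos one_ne_zero (y.2.2 - (h • x₁ i + h • x₂ j))).ne'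
      simp only [noiseDensity, genieMean, relayRatio, Prod.fst_sub, Prod.snd_sub]
      field_simp
    simp only [hterm]
    rw [← Finset.mul_sum, show ∑ i : Fin M₁, gaussDensity 1 (y.2.1 - hc • x₁ i)
      * gaussDensity v (y.2.2 - h • x₁ i) = M₁ * mixDensity x₁ hc h v y.2.1 y.2.2 by
        rw [mixDensity]; field_simp]
    field_simp
  · have hM₂ : (0 : ℝ) < M₂ := Nat.cast_pos.2 (NeZero.pos M₂)
    simp only [ENNReal.ofReal_mul (gaussDensity_nonneg _)]
    rw [Measure.volume_eq_prod, lintegral_prod_mul (f := fun t : Fin n → ℝ =>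
        ENNReal.ofReal (gaussDensity 1 (t - 0)))
        (g := fun p : (Fin n → ℝ) × (Fin n → ℝ) => ENNReal.ofReal
          ((∑ j, mixDensity x₁ hc h 1 p.1 (p.2 - h • x₂ j)) / M₂)) (by fun_prop) (by fun_prop),
      lintegral_gaussDensity_sub one_ne_zero, one_mul]
    have e : ∀ p : (Fin n → ℝ) × (Fin n → ℝ),
        ENNReal.ofReal ((∑ j, mixDensity x₁ hc h 1 p.1 (p.2 - h • x₂ j)) / M₂)
        = (∑ j, ENNReal.ofReal (mixDensity x₁ hc h 1 p.1 (p.2 - h • x₂ j))) * (M₂ : ℝ≥0∞)⁻¹ := by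
      intro p
      rw [ENNReal.ofReal_div_of_pos hM₂, ENNReal.ofReal_sum_of_nonneg
        (fun j _ => mixDensity_nonneg x₁ hc h 1 _ _), ENNReal.ofReal_natCast, div_eq_mul_inv]
    simp only [e]
    rw [lintegral_mul_const _ (by fun_prop), lintegral_finsetSum _ (fun j _ => by fun_prop)]
    simp only [lintegral_mixDensity x₁ hc h one_ne_zero, Finset.sum_const, Finset.card_univ,
      Fintype.card_fin, nsmul_eq_mul, mul_one]
    exact ENNReal.mul_inv_le_one _

end Genie

/-! ### The genie-aided bound -/

section GenieBound

variable {M₁ M₂ n : ℕ}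

/-- Exchanging the roles of the two users. -/
def swapUsers (ω : Outcome M₁ M₂ n) : Outcome M₂ M₁ n :=
  (ω.1.swap, (ω.2.2.1, ω.2.1, ω.2.2.2))

lemma measurePreserving_swapUsers [NeZero M₁] [NeZero M₂] :
    MeasurePreserving (swapUsers : Outcome M₁ M₂ n → Outcome M₂ M₁ n)
      (law M₁ M₂ n) (law M₂ M₁ n) := by
  have hassoc := measurePreserving_prodAssoc (noise n) (noise n) (noise n)
  have h := (Measure.measurePreserving_swap (μ := uniformOn (Set.univ : Set (Fin M₁)))
      (ν := uniformOn (Set.univ : Set (Fin M₂)))).prod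
    ((hassoc.comp ((Measure.measurePreserving_swap (μ := noise n) (ν := noise n)).prod
      (MeasurePreserving.id (noise n)))).comp (hassoc.symm MeasurableEquiv.prodAssoc))
  exact h

/-- The genie-aided bound: if each receiver, given its own signal, the genie signal and the relay's
observation, estimates its message, then the two probabilities of success limit the numbers of
messages. -/
theorem genie_bound [NeZero M₁] [NeZero M₂] {x₁ : Fin M₁ → Fin n → ℝ}
    {x₂ : Fin M₂ → Fin n → ℝ} {P : ℝ} (hP : 0 ≤ P) (hd : ℝ) {hc h : ℝ} (hc0 : hc ≠ 0) (hh0 : h ≠ 0)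
    (h₁ : ∑ w, ∑ k, x₁ w k ^ 2 ≤ M₁ * (n * P)) (h₂ : ∑ w, ∑ k, x₂ w k ^ 2 ≤ M₂ * (n * P))
    {D₁ : (Fin n → ℝ) × (Fin n → ℝ) × (Fin n → ℝ) → Fin M₁} (hD₁ : Measurable D₁)
    {D₂ : (Fin n → ℝ) × (Fin n → ℝ) × (Fin n → ℝ) → Fin M₂} (hD₂ : Measurable D₂) :
    (law M₁ M₂ n).real {ω | D₁ (ω.2 + genieMean hd hc h x₁ x₂ ω.1) = ω.1.1} * Real.log M₁
      + (law M₁ M₂ n).real {ω | D₂ ((swapUsers ω).2 + genieMean hd hc h x₂ x₁ (swapUsers ω).1)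
          = ω.1.2} * Real.log M₂
      - 2 * Real.log 2
      ≤ n * Real.log (1 + (hc ^ 2 / h ^ 2 + (1 - hd / hc) ^ 2))
        + n * Real.log (1 + h ^ 2 * P) := by
  have hM₁ : (0 : ℝ) < M₁ := Nat.cast_pos.2 (NeZero.pos M₁)
  have hM₂ : (0 : ℝ) < M₂ := Nat.cast_pos.2 (NeZero.pos M₂)
  have hs₀ : 0 < 1 + (hc ^ 2 / h ^ 2 + (1 - hd / hc) ^ 2) := by positivity
  have hv₀ : 0 < 1 + h ^ 2 * P := by positivity
  obtain ⟨s, hs⟩ : ∃ s : ℝ≥0, (s : ℝ) = 1 + (hc ^ 2 / h ^ 2 + (1 - hd / hc) ^ 2) :=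
    ⟨⟨_, hs₀.le⟩, rfl⟩
  obtain ⟨v, hv⟩ : ∃ v : ℝ≥0, (v : ℝ) = 1 + h ^ 2 * P := ⟨⟨_, hv₀.le⟩, rfl⟩
  have hs0 : s ≠ 0 := by rw [← NNReal.coe_ne_zero, hs]; exact hs₀.ne'
  have hv0 : v ≠ 0 := by rw [← NNReal.coe_ne_zero, hv]; exact hv₀.ne'
  set Y₁ : Outcome M₁ M₂ n → (Fin n → ℝ) × (Fin n → ℝ) × (Fin n → ℝ) := fun ω =>
    ω.2 + genieMean hd hc h x₁ x₂ ω.1 with hY₁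
  set Y₂ : Outcome M₁ M₂ n → (Fin n → ℝ) × (Fin n → ℝ) × (Fin n → ℝ) := fun ω =>
    (swapUsers ω).2 + genieMean hd hc h x₂ x₁ (swapUsers ω).1 with hY₂
  set S₁ : Set (Outcome M₁ M₂ n) := {ω | D₁ (Y₁ ω) = ω.1.1}
  set S₂ : Set (Outcome M₁ M₂ n) := {ω | D₂ (Y₂ ω) = ω.1.2}
  have mp := measurePreserving_swapUsers (M₁ := M₁) (M₂ := M₂) (n := n)
  have hY₁m : Measurable Y₁ := measurable_of_forall_message fun w =>
    measurable_id.add_const (genieMean hd hc h x₁ x₂ w)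
  have hY₂m : Measurable Y₂ := (measurable_of_forall_message (f := fun ω : Outcome M₂ M₁ n =>
    ω.2 + genieMean hd hc h x₂ x₁ ω.1) fun w =>
      measurable_id.add_const (genieMean hd hc h x₂ x₁ w)).comp mp.measurable
  have hS₁ : MeasurableSet S₁ :=
    measurableSet_eq_fun (hD₁.comp hY₁m) (measurable_fst.comp measurable_fst)
  have hS₂ : MeasurableSet S₂ :=
    measurableSet_eq_fun (hD₂.comp hY₂m) (measurable_snd.comp measurable_fst)
  -- The four likelihood ratios: two per user.
  obtain ⟨a1, b1, c1⟩ := fanoRatio_lintegral_le_one hd hc h x₁ x₂ hs0 hv0 hD₁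
  obtain ⟨a2, b2, c2⟩ := fanoRatio_lintegral_le_one hd hc h x₂ x₁ hs0 hv0 hD₂
  obtain ⟨a3, b3, c3⟩ := relayRatio_lintegral_le_one hd hc h x₁ x₂ hv0
  obtain ⟨a4, b4, c4⟩ := relayRatio_lintegral_le_one hd hc h x₂ x₁ hv0
  rw [← mp.lintegral_comp (by fun_prop)] at c2 c4
  have c2' := a2.comp mp.measurable
  have c4' := a4.comp mp.measurable
  set r : Fin 4 → Outcome M₁ M₂ n → ℝ := ![
    fun ω => fanoRatio hd hc h s v x₁ x₂ D₁ ω.1 (Y₁ ω),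
    fun ω => fanoRatio hd hc h s v x₂ x₁ D₂ ω.1.swap (Y₂ ω),
    fun ω => relayRatio hc h v x₁ x₂ ω.1 (Y₁ ω),
    fun ω => relayRatio hc h v x₂ x₁ ω.1.swap (Y₂ ω)] with hr
  have rm : ∀ i, Measurable (r i) := by
    intro i; fin_cases i
    exacts [a1, c2', a3, c4']
  have r0 : ∀ i ω, 0 ≤ r i ω := by
    intro i ω; fin_cases i
    exacts [b1 ω, b2 (swapUsers ω), b3 ω, b4 (swapUsers ω)]
  have r1 : ∀ i, ∫⁻ ω, ENNReal.ofReal (r i ω) ∂law M₁ M₂ n ≤ 1 := by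
    intro i; fin_cases i
    exacts [c1, c2, c3, c4]
  have hpow₁ : n * ((0 : ℝ) ^ 2 + 0 ^ 2 + 1 ^ 2)
      + (∑ w : Fin M₁ × Fin M₂, ∑ k, (h • x₁ w.1) k ^ 2) / (M₁ * M₂) ≤ n * (1 + h ^ 2 * P) := by
    have : (∑ w : Fin M₁ × Fin M₂, ∑ k, (h • x₁ w.1) k ^ 2) / (M₁ * M₂) ≤ n * (h ^ 2 * P) := by
      rw [div_le_iff₀ (by positivity), Fintype.sum_prod_type_right]
      simp only [Pi.smul_apply, smul_eq_mul, mul_pow, ← Finset.mul_sum, Finset.sum_const,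
        Finset.card_univ, Fintype.card_fin, nsmul_eq_mul]
      have := mul_le_mul_of_nonneg_left h₁ (mul_nonneg hM₂.le (sq_nonneg h))
      linarith
    linarith
  have hpow₂ : n * ((0 : ℝ) ^ 2 + 0 ^ 2 + 1 ^ 2)
      + (∑ w : Fin M₁ × Fin M₂, ∑ k, (h • x₂ w.2) k ^ 2) / (M₁ * M₂) ≤ n * (1 + h ^ 2 * P) := by
    have : (∑ w : Fin M₁ × Fin M₂, ∑ k, (h • x₂ w.2) k ^ 2) / (M₁ * M₂) ≤ n * (h ^ 2 * P) := by
      rw [div_le_iff₀ (by positivity), Fintype.sum_prod_type]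
      simp only [Pi.smul_apply, smul_eq_mul, mul_pow, ← Finset.mul_sum, Finset.sum_const,
        Finset.card_univ, Fintype.card_fin, nsmul_eq_mul]
      have := mul_le_mul_of_nonneg_left h₂ (mul_nonneg hM₁.le (sq_nonneg h))
      linarith
    linarith
  -- Residuals of the affine estimates of the receivers' signals: the codewords cancel.
  set e₁ : Outcome M₁ M₂ n → Fin n → ℝ := fun ω =>
    (Y₁ ω).1 - ((hc / h) • (Y₁ ω).2.2 - (1 - hd / hc) • (Y₁ ω).2.1)
  set e₂ : Outcome M₁ M₂ n → Fin n → ℝ := fun ω =>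
    (Y₂ ω).1 - ((hc / h) • (Y₂ ω).2.2 - (1 - hd / hc) • (Y₂ ω).2.1)
  set f₁ : Outcome M₁ M₂ n → Fin n → ℝ := fun ω => (Y₁ ω).2.2 - h • x₁ ω.1.1
  set f₂ : Outcome M₁ M₂ n → Fin n → ℝ := fun ω => (Y₂ ω).2.2 - h • x₂ ω.1.2
  obtain ⟨k1, l1⟩ := le_integral_log_gaussDensity_sub_log hs0 (res := e₁) (ζ := fun ω => ω.2.2.1)
    1 (1 - hd / hc) (-(hc / h)) 0
    (by
      intro ω k
      simp [e₁, hY₁, genieMean]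
      field_simp
      ring)
    (by simp [hs]; ring_nf; rfl) 0 1 0 (by intro ω k; simp) (by norm_num)
  obtain ⟨k2, l2⟩ := le_integral_log_gaussDensity_sub_log hs0 (res := e₂) (ζ := fun ω => ω.2.1)
    (1 - hd / hc) 1 (-(hc / h)) 0
    (by
      intro ω k
      simp [e₂, hY₂, genieMean, swapUsers]
      field_simp
      ring)
    (by simp [hs]; ring_nf; rfl) 1 0 0 (by intro ω k; simp) (by norm_num)
  obtain ⟨k3, l3⟩ := le_integral_log_gaussDensity_sub_log hv0 (res := f₁) (ζ := fun ω => ω.2.2.2)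
    0 0 1 (fun w => h • x₂ w.2)
    (by intro ω k; simp [f₁, hY₁, genieMean]; ring)
    (by rw [hv]; exact hpow₂) 0 0 1 (by intro ω k; simp) (by norm_num)
  obtain ⟨k4, l4⟩ := le_integral_log_gaussDensity_sub_log hv0 (res := f₂) (ζ := fun ω => ω.2.2.2)
    0 0 1 (fun w => h • x₁ w.1)
    (by intro ω k; simp [f₂, hY₂, genieMean, swapUsers]; ring)
    (by rw [hv]; exact hpow₁) 0 0 1 (by intro ω k; simp) (by norm_num)
  obtain ⟨k5, l5⟩ := integral_indicator_mul_sub_log_two (μ := law M₁ M₂ n) hS₁ (Real.log M₁)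
  obtain ⟨k6, l6⟩ := integral_indicator_mul_sub_log_two (μ := law M₁ M₂ n) hS₂ (Real.log M₂)
  have key := integral_nonpos_of_le_sum_sub_one Finset.univ
    (((((k5.add k6).add k1).add k2).add k3).add k4) rm r0 r1 (fun ω => by
      have g1 := log_fanoRatio_le hd hc h x₁ x₂ (D := D₁) hs0 hv0 ω.1 (Y₁ ω)
      have g2 := log_fanoRatio_le hd hc h x₂ x₁ (D := D₂) hs0 hv0 ω.1.swap (Y₂ ω)
      have g3 := log_relayRatio_le hc h x₁ x₂ hv0 ω.1 (Y₁ ω)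
      have g4 := log_relayRatio_le hc h x₂ x₁ hv0 ω.1.swap (Y₂ ω)
      have q1 := le_log_card_mul_softGuess (D₁ (Y₁ ω)) ω.1.1
      have q2 := le_log_card_mul_softGuess (D₂ (Y₂ ω)) ω.1.2
      have i1 : S₁.indicator (1 : Outcome M₁ M₂ n → ℝ) ω = if D₁ (Y₁ ω) = ω.1.1 then 1 else 0 := by
        simp [Set.indicator_apply, S₁]
      have i2 : S₂.indicator (1 : Outcome M₁ M₂ n → ℝ) ω = if D₂ (Y₂ ω) = ω.1.2 then 1 else 0 := by
        simp [Set.indicator_apply, S₂]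
      -- Removing its own codeword, each receiver is left with the other's genie signal, so that
      -- the mixture densities cancel between the four ratios.
      have t1 : (Y₁ ω).2.1 - hc • x₁ ω.1.1 = ω.2.2.1 := by
        simp [hY₁, genieMean]
      have t2 : (Y₂ ω).2.1 - hc • x₂ ω.1.2 = ω.2.1 := by
        simp [hY₂, genieMean, swapUsers]
      have t3 : (Y₁ ω).1 - hd • x₁ ω.1.1 = (Y₂ ω).2.1 := by
        simp only [hY₁, hY₂, genieMean, swapUsers, Prod.fst_add, Prod.snd_add, Prod.fst_swap]
        abel
      have t4 : (Y₂ ω).1 - hd • x₂ ω.1.2 = (Y₁ ω).2.1 := by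
        simp only [hY₁, hY₂, genieMean, swapUsers, Prod.fst_add, Prod.snd_add, Prod.fst_swap,
          Prod.snd_swap]
        abel
      have t5 : (Y₂ ω).2.2 = (Y₁ ω).2.2 := by
        simp only [hY₁, hY₂, genieMean, swapUsers, Prod.snd_add, Prod.fst_swap, Prod.snd_swap]
        abel
      have t6 : (Y₁ ω).2.2 - (h • x₁ ω.1.1 + h • x₂ ω.1.2) = ω.2.2.2 := by
        simp [hY₁, genieMean]
      have t7 : (Y₁ ω).2.2 - (h • x₂ ω.1.2 + h • x₁ ω.1.1) = ω.2.2.2 := by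
        rw [add_comm (h • x₂ ω.1.2), t6]
      have u1 : e₁ ω = (Y₁ ω).1 - ((hc / h) • (Y₁ ω).2.2 - (1 - hd / hc) • (Y₁ ω).2.1) := rfl
      have u2 : e₂ ω = (Y₂ ω).1 - ((hc / h) • (Y₁ ω).2.2 - (1 - hd / hc) • (Y₂ ω).2.1) := by
        rw [← t5]
      have u3 : f₁ ω = (Y₁ ω).2.2 - h • x₁ ω.1.1 := rfl
      have u4 : f₂ ω = (Y₁ ω).2.2 - h • x₂ ω.1.2 := by rw [← t5]
      simp only [Prod.fst_swap, Prod.snd_swap, Fintype.card_fin, t1, t2, t3, t4, t5, t6, t7,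
        ← u1, ← u2, ← u3, ← u4] at g1 g2 g3 g4 q1 q2
      have hsum : ∑ i, (r i ω - 1) = (fanoRatio hd hc h s v x₁ x₂ D₁ ω.1 (Y₁ ω) - 1)
          + (fanoRatio hd hc h s v x₂ x₁ D₂ ω.1.swap (Y₂ ω) - 1)
          + (relayRatio hc h v x₁ x₂ ω.1 (Y₁ ω) - 1)
          + (relayRatio hc h v x₂ x₁ ω.1.swap (Y₂ ω) - 1) := by
        rw [Fin.sum_univ_four]; rfl
      rw [hsum]
      simp only [Pi.add_apply, i1, i2]
      linarith)
  rw [integral_add' ((((k5.add k6).add k1).add k2).add k3) k4,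
    integral_add' (((k5.add k6).add k1).add k2) k3, integral_add' ((k5.add k6).add k1) k2,
    integral_add' (k5.add k6) k1, integral_add' k5 k6, l5, l6] at key
  rw [hs] at l1 l2
  rw [hv] at l3 l4
  linarith

end GenieBound

/-! ### Bounds for codes -/

section CodeBounds

variable {M₁ M₂ n : ℕ}

lemma PowerConstraint.sum_sq_le [NeZero M₁] [NeZero M₂] {P : ℝ} (hP : 0 ≤ P)
    {d : Fin M₁ × Fin M₂ → Fin n → ℝ}
    (h : PowerConstraint P fun ω : Outcome M₁ M₂ n => d ω.1) :
    ∑ w, ∑ k, d w k ^ 2 ≤ M₁ * M₂ * (n * P) := by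
  have hM₁ : (0 : ℝ) < M₁ := Nat.cast_pos.2 (NeZero.pos M₁)
  have hM₂ : (0 : ℝ) < M₂ := Nat.cast_pos.2 (NeZero.pos M₂)
  obtain ⟨hi, he⟩ := integrable_integral_energy (n := n) 0 0 0 d
  simp only [zero_mul, zero_add] at hi he
  have hdm : ∀ k, Measurable fun ω : Outcome M₁ M₂ n => d ω.1 k := fun k =>
    measurable_of_forall_message fun w => measurable_const (a := d w k)
  rw [PowerConstraint, ← lintegral_finsetSum _ (fun k _ => by have := hdm k; fun_prop)] at h
  simp only [← ENNReal.ofReal_sum_of_nonneg (fun k _ => sq_nonneg (d _ k))] at h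
  rw [← ofReal_integral_eq_lintegral_ofReal hi
    (ae_of_all _ fun ω => Finset.sum_nonneg fun k _ => sq_nonneg _),
    ENNReal.ofReal_le_ofReal_iff (by positivity), he] at h
  norm_num at h
  rw [div_le_iff₀ (by positivity)] at h
  linarith

variable (c : Code M₁ M₂ n) (ch : Channel)

lemma Code.sum_enc₁_sq_le [NeZero M₁] [NeZero M₂] {P : ℝ} (hP : 0 ≤ P)
    (h : PowerConstraint P c.x₁) : ∑ w, ∑ k, c.enc₁ w k ^ 2 ≤ M₁ * (n * P) := by
  have hM₂ : (0 : ℝ) < M₂ := Nat.cast_pos.2 (NeZero.pos M₂)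
  have h' := PowerConstraint.sum_sq_le hP (d := fun w => c.enc₁ w.1) h
  rw [Fintype.sum_prod_type_right] at h'
  simp only [Finset.sum_const, Finset.card_univ, Fintype.card_fin, nsmul_eq_mul] at h'
  nlinarith

lemma Code.sum_enc₂_sq_le [NeZero M₁] [NeZero M₂] {P : ℝ} (hP : 0 ≤ P)
    (h : PowerConstraint P c.x₂) : ∑ w, ∑ k, c.enc₂ w k ^ 2 ≤ M₂ * (n * P) := by
  have hM₁ : (0 : ℝ) < M₁ := Nat.cast_pos.2 (NeZero.pos M₁)
  have h' := PowerConstraint.sum_sq_le hP (d := fun w => c.enc₂ w.2) h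
  rw [Fintype.sum_prod_type] at h'
  simp only [Finset.sum_const, Finset.card_univ, Fintype.card_fin, nsmul_eq_mul] at h'
  nlinarith

/-- The relay's input block as a function of its whole block of observations; causality is
immaterial for the converse. -/
def Code.relayMap (y : Fin n → ℝ) : Fin n → ℝ := fun k =>
  c.relay k fun j => y (Fin.castLE k.isLt.le j)

@[fun_prop]
lemma Code.measurable_relayMap : Measurable c.relayMap :=
  measurable_pi_lambda _ fun k => (c.measurable_relay k).comp
    (measurable_pi_lambda _ fun _ => measurable_pi_apply _)

lemma Code.measurable_y₁ : Measurable (c.y₁ ch) :=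
  measurable_of_forall_message fun w => by
    have h : Measurable fun z : (Fin n → ℝ) × (Fin n → ℝ) × (Fin n → ℝ) =>
        c.relayMap (c.yr ch (w, z)) := by
      unfold Code.yr Code.x₁ Code.x₂; fun_prop
    refine measurable_pi_lambda _ fun k => ?_
    have hk : Measurable fun z => c.relayMap (c.yr ch (w, z)) k := (measurable_pi_apply k).comp h
    change Measurable fun z : (Fin n → ℝ) × (Fin n → ℝ) × (Fin n → ℝ) =>
      ch.hd * c.enc₁ w.1 k + ch.hc * c.enc₂ w.2 k + ch.hr * c.relayMap (c.yr ch (w, z)) k + z.1 k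
    fun_prop

lemma Code.measurable_y₂ : Measurable (c.y₂ ch) :=
  measurable_of_forall_message fun w => by
    have h : Measurable fun z : (Fin n → ℝ) × (Fin n → ℝ) × (Fin n → ℝ) =>
        c.relayMap (c.yr ch (w, z)) := by
      unfold Code.yr Code.x₁ Code.x₂; fun_prop
    refine measurable_pi_lambda _ fun k => ?_
    have hk : Measurable fun z => c.relayMap (c.yr ch (w, z)) k := (measurable_pi_apply k).comp h
    change Measurable fun z : (Fin n → ℝ) × (Fin n → ℝ) × (Fin n → ℝ) =>
      ch.hd * c.enc₂ w.2 k + ch.hc * c.enc₁ w.1 k + ch.hr * c.relayMap (c.yr ch (w, z)) k + z.2.1 k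
    fun_prop

lemma Code.one_sub_errorProb_le₁ [NeZero M₁] [NeZero M₂] :
    1 - c.errorProb ch ≤ (law M₁ M₂ n).real {ω | c.dec₁ (c.y₁ ch ω) = ω.1.1} := by
  have hm : MeasurableSet {ω : Outcome M₁ M₂ n | c.dec₁ (c.y₁ ch ω) = ω.1.1} :=
    measurableSet_eq_fun (c.measurable_dec₁.comp (c.measurable_y₁ ch))
      (measurable_fst.comp measurable_fst)
  have h := probReal_compl_eq_one_sub (μ := law M₁ M₂ n) hm
  have : (law M₁ M₂ n).real {ω : Outcome M₁ M₂ n | c.dec₁ (c.y₁ ch ω) = ω.1.1}ᶜ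
      ≤ c.errorProb ch := measureReal_mono fun ω hω => Or.inl hω
  linarith

lemma Code.one_sub_errorProb_le₂ [NeZero M₁] [NeZero M₂] :
    1 - c.errorProb ch ≤ (law M₁ M₂ n).real {ω | c.dec₂ (c.y₂ ch ω) = ω.1.2} := by
  have hm : MeasurableSet {ω : Outcome M₁ M₂ n | c.dec₂ (c.y₂ ch ω) = ω.1.2} :=
    measurableSet_eq_fun (c.measurable_dec₂.comp (c.measurable_y₂ ch))
      (measurable_snd.comp measurable_fst)
  have h := probReal_compl_eq_one_sub (μ := law M₁ M₂ n) hm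
  have : (law M₁ M₂ n).real {ω : Outcome M₁ M₂ n | c.dec₂ (c.y₂ ch ω) = ω.1.2}ᶜ
      ≤ c.errorProb ch := measureReal_mono fun ω hω => Or.inr hω
  linarith

theorem Code.genie_bound [NeZero M₁] [NeZero M₂] (hc : ch.hc ≠ 0) (hsr : ch.hsr ≠ 0)
    (hP : 0 ≤ ch.P) (hadm : c.Admissible ch) :
    (1 - c.errorProb ch) * (Real.log M₁ + Real.log M₂) - 2 * Real.log 2
      ≤ n * (Real.log (1 + (ch.hc ^ 2 / ch.hsr ^ 2 + (1 - ch.hd / ch.hc) ^ 2))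
        + Real.log (1 + ch.hsr ^ 2 * ch.P)) := by
  have hD₁ : Measurable fun y : (Fin n → ℝ) × (Fin n → ℝ) × (Fin n → ℝ) =>
      c.dec₁ (y.1 + ch.hr • c.relayMap y.2.2) := c.measurable_dec₁.comp (by fun_prop)
  have hD₂ : Measurable fun y : (Fin n → ℝ) × (Fin n → ℝ) × (Fin n → ℝ) =>
      c.dec₂ (y.1 + ch.hr • c.relayMap y.2.2) := c.measurable_dec₂.comp (by fun_prop)
  have key := InterferenceRelay.genie_bound hP ch.hd hc hsr (c.sum_enc₁_sq_le hP hadm.1)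
    (c.sum_enc₂_sq_le hP hadm.2.1) hD₁ hD₂
  have hr₁ : ∀ ω : Outcome M₁ M₂ n,
      (ω.2 + genieMean ch.hd ch.hc ch.hsr c.enc₁ c.enc₂ ω.1).2.2 = c.yr ch ω := fun ω => by
    ext k
    simp [genieMean, Code.yr, Code.x₁, Code.x₂]
    ring
  have hr₂ : ∀ ω : Outcome M₁ M₂ n, ((swapUsers ω).2
      + genieMean ch.hd ch.hc ch.hsr c.enc₂ c.enc₁ (swapUsers ω).1).2.2 = c.yr ch ω := fun ω => by
    ext k
    simp [genieMean, Code.yr, Code.x₁, Code.x₂, swapUsers]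
    ring
  have hy₁ : ∀ ω : Outcome M₁ M₂ n,
      (ω.2 + genieMean ch.hd ch.hc ch.hsr c.enc₁ c.enc₂ ω.1).1
        + ch.hr • c.relayMap (c.yr ch ω) = c.y₁ ch ω := fun ω => by
    ext k
    simp [genieMean, Code.y₁, Code.x₁, Code.x₂, Code.xr, Code.relayMap]
    ring
  have hy₂ : ∀ ω : Outcome M₁ M₂ n,
      ((swapUsers ω).2 + genieMean ch.hd ch.hc ch.hsr c.enc₂ c.enc₁ (swapUsers ω).1).1
        + ch.hr • c.relayMap (c.yr ch ω) = c.y₂ ch ω := fun ω => by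
    ext k
    simp [genieMean, Code.y₂, Code.x₁, Code.x₂, Code.xr, Code.relayMap, swapUsers]
    ring
  simp only [hr₁, hr₂, hy₁, hy₂] at key
  have h₁ := mul_le_mul_of_nonneg_right (c.one_sub_errorProb_le₁ ch)
    (Real.log_natCast_nonneg M₁)
  have h₂ := mul_le_mul_of_nonneg_right (c.one_sub_errorProb_le₂ ch)
    (Real.log_natCast_nonneg M₂)
  linarith

/-- Messages, relay noise, and a rotated combination of the noises at the two receivers have a joint
law that does not depend on the rotation. -/
lemma measurePreserving_rotate {α β : ℝ} (h : α ^ 2 + β ^ 2 = 1) :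
    MeasurePreserving
      (fun ω : Outcome M₁ M₂ n =>
        (ω.1, ((fun k => α * ω.2.1 k + β * ω.2.2.1 k : Fin n → ℝ), ω.2.2.2)))
      (law M₁ M₂ n)
      (((uniformOn Set.univ).prod (uniformOn Set.univ)).prod ((noise n).prod (noise n))) := by
  have hrot : MeasurePreserving (fun p : (Fin n → ℝ) × (Fin n → ℝ) => fun k =>
      α * p.1 k + β * p.2 k) ((noise n).prod (noise n)) (noise n) :=
    ⟨by fun_prop, map_noise_rotate h⟩
  have hassoc := measurePreserving_prodAssoc (noise n) (noise n) (noise n)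
  exact (MeasurePreserving.id _).prod
    ((hrot.prod (MeasurePreserving.id (noise n))).comp (hassoc.symm MeasurableEquiv.prodAssoc))

/-- Replacing the noise at a receiver by a rotated combination of both receivers' noises leaves the
probability of an event unchanged. -/
lemma law_real_rotate {A : Set ((Fin M₁ × Fin M₂) × (Fin n → ℝ) × (Fin n → ℝ))}
    (hA : MeasurableSet A) {α β α' β' : ℝ} (h : α ^ 2 + β ^ 2 = 1) (h' : α' ^ 2 + β' ^ 2 = 1) :
    (law M₁ M₂ n).real {ω | (ω.1, ((fun k => α * ω.2.1 k + β * ω.2.2.1 k : Fin n → ℝ),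
      ω.2.2.2)) ∈ A}
    = (law M₁ M₂ n).real {ω | (ω.1, ((fun k => α' * ω.2.1 k + β' * ω.2.2.1 k : Fin n → ℝ),
      ω.2.2.2)) ∈ A} :=
  ((measurePreserving_rotate h).measureReal_preimage hA.nullMeasurableSet).trans
    ((measurePreserving_rotate h').measureReal_preimage hA.nullMeasurableSet).symm

/-- A receiver whose noise is scaled down by `τ` decodes both messages: adding noise gives it the
first receiver's signal, and, once that message is known, the second receiver's signal. -/
theorem Code.joint_bound [NeZero M₁] [NeZero M₂] (hc : 0 < ch.hc) (hd : 0 ≤ ch.hd)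
    (hP : 0 ≤ ch.P) (hadm : c.Admissible ch) {τ : ℝ} (hτ : 0 < τ) (hτ₁ : τ ≤ 1)
    (hτ₂ : ch.hd * τ ≤ ch.hc) :
    (1 - 2 * c.errorProb ch) * (Real.log M₁ + Real.log M₂) - Real.log 2
      ≤ n * (1 / 2 * Real.log (1 + (ch.hd ^ 2 + ch.hc ^ 2) / τ ^ 2 * ch.P)
        + 1 / 2 * Real.log (1 + 2 * ch.hsr ^ 2 * ch.P)) := by
  have hM₁ : (0 : ℝ) < M₁ := Nat.cast_pos.2 (NeZero.pos M₁)
  have hM₂ : (0 : ℝ) < M₂ := Nat.cast_pos.2 (NeZero.pos M₂)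
  set σ := ch.hd * τ / ch.hc with hσ
  have hσ0 : 0 ≤ σ := by positivity
  have hσ1 : σ ≤ 1 := (div_le_one hc).2 hτ₂
  have rotτ : τ ^ 2 + Real.sqrt (1 - τ ^ 2) ^ 2 = 1 := by
    rw [Real.sq_sqrt (by nlinarith)]; ring
  have rotσ : σ ^ 2 + Real.sqrt (1 - σ ^ 2) ^ 2 = 1 := by
    rw [Real.sq_sqrt (by nlinarith)]; ring
  set τ' := Real.sqrt (1 - τ ^ 2)
  set σ' := Real.sqrt (1 - σ ^ 2)
  set W₁ : (Fin n → ℝ) × (Fin n → ℝ) × (Fin n → ℝ) → Fin M₁ := fun y =>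
    c.dec₁ (τ • y.1 + τ' • y.2.1 + ch.hr • c.relayMap y.2.2) with hW₁
  set D : (Fin n → ℝ) × (Fin n → ℝ) × (Fin n → ℝ) → Fin M₁ × Fin M₂ := fun y =>
    (W₁ y, c.dec₂ (ch.hc • c.enc₁ (W₁ y) + (ch.hd / ch.hc) • (τ • y.1 - ch.hd • c.enc₁ (W₁ y))
      + σ' • y.2.1 + ch.hr • c.relayMap y.2.2)) with hD
  have hW₁m : Measurable W₁ := c.measurable_dec₁.comp (by fun_prop)
  have henc : Measurable fun y => c.enc₁ (W₁ y) :=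
    (Measurable.of_discrete (f := c.enc₁)).comp hW₁m
  have hDm : Measurable D := hW₁m.prodMk (c.measurable_dec₂.comp (by fun_prop))
  have key := joint_decoding_bound hP (ch.hd / τ) (ch.hc / τ) ch.hsr (c.sum_enc₁_sq_le hP hadm.1)
    (c.sum_enc₂_sq_le hP hadm.2.1) (fun _ => rfl) hDm
  set m : Fin M₁ × Fin M₂ → (Fin n → ℝ) × (Fin n → ℝ) × (Fin n → ℝ) := fun w =>
    ((ch.hd / τ) • c.enc₁ w.1 + (ch.hc / τ) • c.enc₂ w.2, 0,
      ch.hsr • c.enc₁ w.1 + ch.hsr • c.enc₂ w.2) with hm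
  -- The decision of each receiver as a function of the messages, its own noise and the relay noise.
  set sig₁ : (Fin M₁ × Fin M₂) × (Fin n → ℝ) × (Fin n → ℝ) → Fin n → ℝ := fun p =>
    ch.hd • c.enc₁ p.1.1 + ch.hc • c.enc₂ p.1.2
      + ch.hr • c.relayMap (p.2.2 + (ch.hsr • c.enc₁ p.1.1 + ch.hsr • c.enc₂ p.1.2)) + p.2.1
    with hsig₁
  set sig₂ : (Fin M₁ × Fin M₂) × (Fin n → ℝ) × (Fin n → ℝ) → Fin n → ℝ := fun p =>
    ch.hd • c.enc₂ p.1.2 + ch.hc • c.enc₁ p.1.1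
      + ch.hr • c.relayMap (p.2.2 + (ch.hsr • c.enc₁ p.1.1 + ch.hsr • c.enc₂ p.1.2)) + p.2.1
    with hsig₂
  have hs₁ : Measurable sig₁ := measurable_from_prod_countable_right fun w => by
    simp only [hsig₁]; fun_prop
  have hs₂ : Measurable sig₂ := measurable_from_prod_countable_right fun w => by
    simp only [hsig₂]; fun_prop
  have hA₁ : MeasurableSet {p | c.dec₁ (sig₁ p) ≠ p.1.1} :=
    (measurableSet_eq_fun (c.measurable_dec₁.comp hs₁) (measurable_fst.comp measurable_fst)).compl
  have hA₂ : MeasurableSet {p | c.dec₂ (sig₂ p) ≠ p.1.2} :=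
    (measurableSet_eq_fun (c.measurable_dec₂.comp hs₂) (measurable_snd.comp measurable_fst)).compl
  have hy₁ : ∀ ω : Outcome M₁ M₂ n, sig₁ (ω.1, (fun k => 1 * ω.2.1 k + 0 * ω.2.2.1 k, ω.2.2.2))
      = c.y₁ ch ω := fun ω => by
    have hyr : ω.2.2.2 + (ch.hsr • c.enc₁ ω.1.1 + ch.hsr • c.enc₂ ω.1.2) = c.yr ch ω := by
      ext k; simp [Code.yr, Code.x₁, Code.x₂]; ring
    ext k
    simp [hsig₁, hyr, Code.y₁, Code.x₁, Code.x₂, Code.xr, Code.relayMap]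
  have hy₂ : ∀ ω : Outcome M₁ M₂ n, sig₂ (ω.1, (fun k => 0 * ω.2.1 k + 1 * ω.2.2.1 k, ω.2.2.2))
      = c.y₂ ch ω := fun ω => by
    have hyr : ω.2.2.2 + (ch.hsr • c.enc₁ ω.1.1 + ch.hsr • c.enc₂ ω.1.2) = c.yr ch ω := by
      ext k; simp [Code.yr, Code.x₁, Code.x₂]; ring
    ext k
    simp [hsig₂, hyr, Code.y₂, Code.x₁, Code.x₂, Code.xr, Code.relayMap]
  have e₁ := law_real_rotate hA₁ rotτ (by norm_num : (1 : ℝ) ^ 2 + 0 ^ 2 = 1)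
  have e₂ := law_real_rotate hA₂ rotσ (by norm_num : (0 : ℝ) ^ 2 + 1 ^ 2 = 1)
  simp only [Set.mem_ofPred_eq, hy₁, hy₂] at e₁ e₂
  set F₁ : Set (Outcome M₁ M₂ n) := {ω | c.dec₁ (sig₁ (ω.1,
    ((fun k => τ * ω.2.1 k + τ' * ω.2.2.1 k : Fin n → ℝ), ω.2.2.2))) ≠ ω.1.1}
  set F₂ : Set (Outcome M₁ M₂ n) := {ω | c.dec₂ (sig₂ (ω.1,
    ((fun k => σ * ω.2.1 k + σ' * ω.2.2.1 k : Fin n → ℝ), ω.2.2.2))) ≠ ω.1.2}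
  have b₁ : (law M₁ M₂ n).real F₁ ≤ c.errorProb ch :=
    e₁.trans_le (measureReal_mono fun ω hω => Or.inl hω)
  have b₂ : (law M₁ M₂ n).real F₂ ≤ c.errorProb ch :=
    e₂.trans_le (measureReal_mono fun ω hω => Or.inr hω)
  have hcover : (Set.univ : Set (Outcome M₁ M₂ n))
      ⊆ {ω | D (ω.2 + m ω.1) = ω.1} ∪ (F₁ ∪ F₂) := by
    intro ω _
    by_cases h1 : ω ∈ F₁
    · exact Or.inr (Or.inl h1)
    by_cases h2 : ω ∈ F₂
    · exact Or.inr (Or.inr h2)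
    left
    simp only [F₁, F₂, Set.mem_ofPred_eq, not_not] at h1 h2
    have hw : W₁ (ω.2 + m ω.1) = ω.1.1 := by
      rw [← h1]
      simp only [hW₁]
      congr 1
      ext k
      simp [hm, hsig₁]
      field_simp
      ring
    refine Prod.ext hw ?_
    simp only [hD, hw]
    rw [← h2]
    congr 1
    ext k
    simp [hm, hsig₂, hσ]
    field_simp
    ring
  have hsucc : 1 - 2 * c.errorProb ch ≤ (law M₁ M₂ n).real {ω | D (ω.2 + m ω.1) = ω.1} := by
    have h1 := measureReal_mono (μ := law M₁ M₂ n) hcover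
    have h2 := measureReal_union_le (μ := law M₁ M₂ n) {ω | D (ω.2 + m ω.1) = ω.1} (F₁ ∪ F₂)
    have h3 := measureReal_union_le (μ := law M₁ M₂ n) F₁ F₂
    rw [probReal_univ] at h1
    linarith
  have hg : (ch.hd / τ) ^ 2 + (ch.hc / τ) ^ 2 = (ch.hd ^ 2 + ch.hc ^ 2) / τ ^ 2 := by
    rw [div_pow, div_pow, add_div]
  rw [Real.log_mul hM₁.ne' hM₂.ne', hg] at key
  have := mul_le_mul_of_nonneg_right hsucc
    (add_nonneg (Real.log_natCast_nonneg M₁) (Real.log_natCast_nonneg M₂))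
  linarith

end CodeBounds

/-! ### Passing to rates -/

section Asymptotics

lemma numMessages_pos (R : ℝ) (n : ℕ) : 0 < numMessages R n :=
  Nat.ceil_pos.2 (Real.rpow_pos_of_pos two_pos _)

instance (R : ℝ) (n : ℕ) : NeZero (numMessages R n) := ⟨(numMessages_pos R n).ne'⟩

lemma le_log_numMessages (R : ℝ) (n : ℕ) : n * (R * Real.log 2) ≤ Real.log (numMessages R n) := by
  have h := Real.log_le_log (Real.rpow_pos_of_pos two_pos _) (Nat.le_ceil ((2 : ℝ) ^ ((n : ℝ) * R)))
  rw [Real.log_rpow two_pos] at h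
  unfold numMessages
  linarith

/-- A bound on the codes of every block length, with vanishing error probability, turns into a
bound on the sum rate. -/
lemma sum_rate_le_of_bound {R₁ R₂ κ a B : ℝ} {pe : ℕ → ℝ}
    (hpe : Tendsto pe atTop (𝓝 0))
    (h : ∀ n, (1 - κ * pe n) * (Real.log (numMessages R₁ n) + Real.log (numMessages R₂ n)) - a
      ≤ n * B) : (R₁ + R₂) * Real.log 2 ≤ B := by
  have hlim : Tendsto (fun n : ℕ => (1 - κ * pe n) * ((R₁ + R₂) * Real.log 2) - a / n) atTop
      (𝓝 ((1 - κ * 0) * ((R₁ + R₂) * Real.log 2) - 0)) :=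
    (((hpe.const_mul κ).const_sub 1).mul_const _).sub (tendsto_const_div_atTop_nhds_zero_nat a)
  have hev : ∀ᶠ n in atTop, 0 < 1 - κ * pe n :=
    ((hpe.const_mul κ).const_sub 1).eventually (lt_mem_nhds (by simp))
  have hle := le_of_tendsto hlim (b := B) (by
    filter_upwards [hev, eventually_gt_atTop 0] with n hn hn0
    have hn' : (0 : ℝ) < n := Nat.cast_pos.2 hn0
    have hlog := mul_le_mul_of_nonneg_left
      (add_le_add (le_log_numMessages R₁ n) (le_log_numMessages R₂ n)) hn.le
    rw [sub_le_iff_le_add, ← mul_le_mul_iff_right₀ hn']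
    have : (n : ℝ) * (B + a / n) = n * B + a := by field_simp
    rw [this]
    linarith [h n])
  simpa using hle

lemma sumCapacity_le {ch : Channel} {b : ℝ} (h : ∀ R, Achievable ch R → R.1 + R.2 ≤ b) :
    sumCapacity ch ≤ (b : EReal) := by
  refine iSup₂_le fun R hR => EReal.coe_le_coe_iff.2 ?_
  have hcl : IsClosed {R : ℝ × ℝ | R.1 + R.2 ≤ b} :=
    isClosed_le (continuous_fst.add continuous_snd) continuous_const
  exact closure_minimal (fun R hR => h R hR) hcl hR

lemma C_mul_log_two (x : ℝ) : C x * Real.log 2 = 1 / 2 * Real.log (1 + x) := by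
  have : Real.log 2 ≠ 0 := (Real.log_pos one_lt_two).ne'
  rw [C, Real.logb]
  field_simp

end Asymptotics

end InterferenceRelay

open InterferenceRelay

theorem theorem3 (hd hc hr hsr P : ℝ) (hd_nonneg : 0 ≤ hd) (hc_pos : 0 < hc)
    (hr_nonneg : 0 ≤ hr) (hsr_nonneg : 0 ≤ hsr) (hP : 0 ≤ P) :
    InterferenceRelay.sumCapacity ⟨hd, hc, hr, hsr, P⟩ ≤
        ((InterferenceRelay.C (2 * hsr ^ 2 * P) + InterferenceRelay.C (hd ^ 2 * P + hc ^ 2 * P)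
          + InterferenceRelay.Cplus (hd ^ 2 / hc ^ 2 - 1) : ℝ) : EReal) ∧
      (0 < hsr →
        InterferenceRelay.sumCapacity ⟨hd, hc, hr, hsr, P⟩ ≤
          ((2 * InterferenceRelay.C (hc ^ 2 / hsr ^ 2 + (1 - hd / hc) ^ 2)
            + 2 * InterferenceRelay.C (2 * hsr ^ 2 * P) : ℝ) : EReal)) := by
  have hlog2 : 0 < Real.log 2 := Real.log_pos one_lt_two
  refine ⟨sumCapacity_le fun R hR => ?_, fun hsr_pos => sumCapacity_le fun R hR => ?_⟩
  · obtain ⟨-, -, c, hadm, hpe⟩ := hR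
    refine le_of_mul_le_mul_right ?_ hlog2
    have e₁ := C_mul_log_two (2 * hsr ^ 2 * P)
    have e₂ := C_mul_log_two (hd ^ 2 * P + hc ^ 2 * P)
    rcases le_total hd hc with hle | hle
    · have key := sum_rate_le_of_bound hpe fun n =>
        (c n).joint_bound ⟨hd, hc, hr, hsr, P⟩ hc_pos hd_nonneg hP (hadm n) one_pos le_rfl
          (by simpa using hle)
      have h0 : 0 ≤ Cplus (hd ^ 2 / hc ^ 2 - 1) * Real.log 2 :=
        mul_nonneg (le_max_left _ _) hlog2.le
      simp only [one_pow, div_one] at key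
      rw [add_mul (hd ^ 2)] at key
      linarith
    · have hd_pos : 0 < hd := hc_pos.trans_le hle
      have key := sum_rate_le_of_bound hpe fun n =>
        (c n).joint_bound ⟨hd, hc, hr, hsr, P⟩ hc_pos hd_nonneg hP (hadm n)
          (div_pos hc_pos hd_pos) ((div_le_one hd_pos).2 hle)
          (by simp only; rw [mul_div_cancel₀ _ hd_pos.ne'])
      have h0 : 1 / 2 * Real.log (hd ^ 2 / hc ^ 2)
          ≤ Cplus (hd ^ 2 / hc ^ 2 - 1) * Real.log 2 := by
        refine le_trans (le_of_eq ?_) (mul_le_mul_of_nonneg_right (le_max_right _ _) hlog2.le)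
        rw [C_mul_log_two]
        congr 2
        ring
      have h1 : Real.log (1 + (hd ^ 2 + hc ^ 2) / (hc / hd) ^ 2 * P)
          ≤ Real.log (1 + (hd ^ 2 * P + hc ^ 2 * P)) + Real.log (hd ^ 2 / hc ^ 2) := by
        rw [← Real.log_mul (by positivity) (by positivity)]
        refine Real.log_le_log (by positivity) ?_
        have h2 : 1 ≤ hd ^ 2 / hc ^ 2 := by
          rw [one_le_div (by positivity)]
          exact pow_le_pow_left₀ hc_pos.le hle 2
        have h3 : (hd ^ 2 + hc ^ 2) / (hc / hd) ^ 2 * P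
            = (hd ^ 2 * P + hc ^ 2 * P) * (hd ^ 2 / hc ^ 2) := by
          field_simp
        rw [h3]
        linarith
      simp only at key
      linarith
  · obtain ⟨-, -, c, hadm, hpe⟩ := hR
    refine le_of_mul_le_mul_right ?_ hlog2
    have e₁ := C_mul_log_two (2 * hsr ^ 2 * P)
    have e₂ := C_mul_log_two (hc ^ 2 / hsr ^ 2 + (1 - hd / hc) ^ 2)
    have key := sum_rate_le_of_bound (κ := 1) hpe fun n => by
      simpa only [one_mul] using
        (c n).genie_bound ⟨hd, hc, hr, hsr, P⟩ hc_pos.ne' hsr_pos.ne' hP (hadm n)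
    have h1 : Real.log (1 + hsr ^ 2 * P) ≤ Real.log (1 + 2 * hsr ^ 2 * P) := by
      have : 0 ≤ hsr ^ 2 * P := by positivity
      exact Real.log_le_log (by positivity) (by linarith)
    linarith
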